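/- Let $0 \le a < b \le \infty$, and let the valuations $v_1,\dots,v_n$ of $n$ agents be drawn i.i.d. from a distribution $F$ with finite mean, with support $R=[a,b]$ ($R=[a,\infty)$ if $b=\infty$) and with a density $f$ that is positive throughout $R$. Assume that the hazard rate $f/(1-F)$ is neither non-decreasing nor non-increasing on $[a,b)$. Let $\vartheta(v)=\frac{1-F(v)}{f(v)}$ and define the ironed virtual valuation $\bar\vartheta$ by: $h(q)=\vartheta(F^{-1}(q))$, $H(q)=\int_0^q h(r)\,dr$, $G$ is the largest convex function on $[0,1]$ with $G\le H$, $g$ is the derivative of $G$ extended by right-continuity (and by the left derivative at $q=1$), and $\bar\vartheta(v)=g(F(v))$. A mechanism for $k$ units maps each profile of actions to a lottery over sets of at most $k$ winners and to non-negative (burnt) expected payments $p_i$; write $x_i$ for the probability that agent $i$ wins. It is considered together with a Bayes–Nash equilibrium that is ex interim individually rational, where agents maximize the expectation of $v_ix_i-p_i$; if $a>0$, payments are normalized so that in equilibrium the lowest type $a$ of each agent has expected utility $0$ (for $a=0$ this holds automatically). It is optimal if its expected residual surplus $\mathbf E\bigl[\sum_i (v_ix_i-p_i)\bigr]$ is at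 least that of every such mechanism and equilibrium, symmetric or not. Let $R'\subseteq R$ be the subrange on which $\bar\vartheta$ increases, i.e. the set of $v\in R$ with $\bar\vartheta(w)<\bar\vartheta(v)$ for all $w\in R$, $w<v$ (so that of each interval on which $\bar\vartheta$ is constant only the lower end point is kept). The indirect $k$-unit Vickrey auction is the mechanism in which each agent submits a bid $s_i\in R'$, the $\min(k,n)$ agents with the highest bids win, ties are broken uniformly at random, and agent $i$ pays in expectation $s_i\,x_i(s)-\int_a^{s_i} x_i(\beta(z),s_{-i})\,dz$, where $\beta(z)$ denotes the largest element of $R'$ that is at most $z$. Then this auction is symmetric; for every $v \in R$ the bid $\beta(v)$ exists and satisfies $\bar\vartheta(\beta(v))=\bar\vartheta(v)$; all agents bidding according to $\beta$ is an ex interim individually rational Bayes–Nash equilibrium; and with this equilibrium the auction is an optimal money-burning mechanism for $k$ units. -/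

import Mathlib

open MeasureTheory ProbabilityTheory Set

noncomputable section

namespace MoneyBurning

/-! ### Valuation distributions -/

/-- The range `R = [a, b]` of valuations; the upper end `b` may be `+∞`. -/
def valueRange (a : ℝ) (b : EReal) : Set ℝ := {v | a ≤ v ∧ (v : EReal) ≤ b}

/-- The law on `ℝ` with density `f`. -/
def law (f : ℝ → ℝ) : Measure ℝ := volume.withDensity fun x => ENNReal.ofReal (f x)

/-- `f` is a probability density with support `[a, b]`, positive throughout this interval, and with
finite mean (automatic for `b < ∞`). -/
structure IsValuationDensity (a : ℝ) (b : EReal) (f : ℝ → ℝ) : Prop where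
  measurable : Measurable f
  pos : ∀ v ∈ valueRange a b, 0 < f v
  zero : ∀ v, v ∉ valueRange a b → f v = 0
  isProbability : IsProbabilityMeasure (law f)
  mean : Integrable (fun v => v) (law f)

/-- The distribution function `F`. -/
def F (f : ℝ → ℝ) (z : ℝ) : ℝ := cdf (law f) z

/-- The hazard rate `f / (1 - F)`, meaningful where `F < 1`. -/
def hazardRate (f : ℝ → ℝ) (v : ℝ) : ℝ := f v / (1 - F f v)

/-- The part of `[a, b]` on which the hazard rate is defined, that is `[a, b)`. -/
def hazardDomain (a : ℝ) (b : EReal) (f : ℝ → ℝ) : Set ℝ := {v ∈ valueRange a b | F f v < 1}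

/-- The hazard rate is monotone in neither direction. -/
def NonMHR (a : ℝ) (b : EReal) (f : ℝ → ℝ) : Prop :=
  ¬ MonotoneOn (hazardRate f) (hazardDomain a b f) ∧
    ¬ AntitoneOn (hazardRate f) (hazardDomain a b f)

/-! ### Virtual valuations for utility and ironing -/

/-- The virtual valuation for utility, `(1 - F) / f`. -/
def virtualValue (f : ℝ → ℝ) (v : ℝ) : ℝ := (1 - F f v) / f v

/-- The inverse of the distribution function on `[a, b]`. -/
def quantile (a : ℝ) (b : EReal) (f : ℝ → ℝ) (q : ℝ) : ℝ := sInf {z ∈ valueRange a b | q ≤ F f z}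

/-- `h(q) = ϑ(F⁻¹(q))`. -/
def hFun (a : ℝ) (b : EReal) (f : ℝ → ℝ) (q : ℝ) : ℝ := virtualValue f (quantile a b f q)

/-- `H(q) = ∫₀^q h(r) dr`. -/
def HFun (a : ℝ) (b : EReal) (f : ℝ → ℝ) (q : ℝ) : ℝ := ∫ r in (0 : ℝ)..q, hFun a b f r

/-- The convex hull of a function on `[0, 1]`: the largest convex function below it. -/
def convexMinorant (H : ℝ → ℝ) (q : ℝ) : ℝ :=
  sSup {y | ∃ c : ℝ → ℝ, ConvexOn ℝ (Icc 0 1) c ∧ (∀ r ∈ Icc (0 : ℝ) 1, c r ≤ H r) ∧ y = c q}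

/-- `G`, the convex hull of `H`. -/
def GFun (a : ℝ) (b : EReal) (f : ℝ → ℝ) : ℝ → ℝ := convexMinorant (HFun a b f)

/-- `g`, the derivative of the convex function `G`, extended by right-continuity on `[0, 1)` (this
is the right derivative); at the end point `1` it is the left derivative. -/
def gFun (a : ℝ) (b : EReal) (f : ℝ → ℝ) (q : ℝ) : ℝ :=
  if q < 1 then derivWithin (GFun a b f) (Ioi q) q else derivWithin (GFun a b f) (Iio 1) 1

/-- The ironed virtual valuation for utility, `g(F(z))`. -/
def ironedValue (a : ℝ) (b : EReal) (f : ℝ → ℝ) (z : ℝ) : ℝ := gFun a b f (F f z)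

/-! ### Mechanisms, equilibria, optimality -/

/-- A (possibly randomized, possibly indirect) mechanism for `n` agents with action space `A`:
an action profile is mapped to a lottery over sets of winners and to the (expected) amount
each agent has to burn. -/
structure Mechanism (n : ℕ) (A : Type) where
  lottery : (Fin n → A) → PMF (Finset (Fin n))
  payment : (Fin n → A) → Fin n → ℝ

namespace Mechanism

variable {n : ℕ} {A : Type}

/-- The probability `xᵢ` that agent `i` is served. -/
def alloc (M : Mechanism n A) (s : Fin n → A) (i : Fin n) : ℝ :=
  ∑ W : Finset (Fin n) with i ∈ W, (M.lottery s W).toReal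

/-- Only sets of at most `k` agents are served, winning probabilities and payments are measurable,
and there are no positive transfers to the agents. -/
structure IsFeasible [MeasurableSpace A] (M : Mechanism n A) (k : ℕ) : Prop where
  units : ∀ s, ∀ W ∈ (M.lottery s).support, W.card ≤ k
  measurable_alloc : ∀ i, Measurable fun s => M.alloc s i
  measurable_payment : ∀ i, Measurable fun s => M.payment s i
  payment_nonneg : ∀ s i, 0 ≤ M.payment s i

/-- Renaming the agents renames the outcome. -/
def IsSymmetric (M : Mechanism n A) : Prop :=
  ∀ (π : Equiv.Perm (Fin n)) (s : Fin n → A),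
    M.lottery (s ∘ π) = (M.lottery s).map (fun W => W.map π.symm.toEmbedding) ∧
      ∀ i, M.payment (s ∘ π) i = M.payment s (π i)

/-- The action profile when the agents with valuations `w` follow `σ`, except that agent `i` takes
the action `t`. -/
def deviate (σ : Fin n → ℝ → A) (i : Fin n) (t : A) (w : Fin n → ℝ) : Fin n → A :=
  Function.update (fun j => σ j (w j)) i t

/-- Expected utility of agent `i` with valuation `v` and action `t`, over the independent
valuations of the other agents (whatever is drawn for `i` itself is overwritten). -/
def interimUtility (M : Mechanism n A) (f : ℝ → ℝ) (σ : Fin n → ℝ → A) (i : Fin n)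
    (v : ℝ) (t : A) : ℝ :=
  v * (∫ w, M.alloc (deviate σ i t w) i ∂(Measure.pi fun _ => law f)) -
    ∫ w, M.payment (deviate σ i t w) i ∂(Measure.pi fun _ => law f)

/-- The expected payment of agent `i` for action `t` is finite. -/
def FinitePayment (M : Mechanism n A) (f : ℝ → ℝ) (σ : Fin n → ℝ → A) (i : Fin n)
    (t : A) : Prop :=
  Integrable (fun w => M.payment (deviate σ i t w) i) (Measure.pi fun _ => law f)

/-- `σ` is a Bayes-Nash equilibrium, ex interim individually rational, of the mechanism `M`.
Actions of infinite expected payment give utility `-∞` and are never profitable. By `normalized`,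
if `a > 0`, the lowest type has utility `0`, that is, payments are
`pᵢ(v) = v xᵢ(v) - ∫₀^v xᵢ` where `xᵢ` vanishes below `a`; for `a = 0` this is no restriction. -/
structure IsEquilibrium [MeasurableSpace A] (M : Mechanism n A) (a : ℝ) (b : EReal) (f : ℝ → ℝ)
    (σ : Fin n → ℝ → A) : Prop where
  measurable : ∀ i, Measurable (σ i)
  finite : ∀ i, ∀ v ∈ valueRange a b, M.FinitePayment f σ i (σ i v)
  best : ∀ i, ∀ v ∈ valueRange a b, ∀ t, M.FinitePayment f σ i t →
    M.interimUtility f σ i v t ≤ M.interimUtility f σ i v (σ i v)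
  rational : ∀ i, ∀ v ∈ valueRange a b, 0 ≤ M.interimUtility f σ i v (σ i v)
  normalized : 0 < a → ∀ i, M.interimUtility f σ i a (σ i a) = 0

/-- Expected residual surplus `E[∑ᵢ (vᵢ xᵢ - pᵢ)]` when the agents follow `σ`. -/
def residualSurplus (M : Mechanism n A) (f : ℝ → ℝ) (σ : Fin n → ℝ → A) : ℝ :=
  ∫ w, ∑ i, (w i * M.alloc (fun j => σ j (w j)) i - M.payment (fun j => σ j (w j)) i)
    ∂(Measure.pi fun _ => law f)

/-- `M` with the equilibrium `σ` is an optimal money-burning mechanism for `k` units: no mechanism,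
with whatever action space and in whatever equilibrium, has a larger expected residual surplus. -/
structure IsOptimal [MeasurableSpace A] (M : Mechanism n A) (k : ℕ) (a : ℝ) (b : EReal)
    (f : ℝ → ℝ) (σ : Fin n → ℝ → A) : Prop where
  feasible : M.IsFeasible k
  equilibrium : M.IsEquilibrium a b f σ
  le : ∀ (B : Type) [MeasurableSpace B] (M' : Mechanism n B) (τ : Fin n → ℝ → B),
    M'.IsFeasible k → M'.IsEquilibrium a b f τ →
      M'.residualSurplus f τ ≤ M.residualSurplus f σ

end Mechanism

/-! ### The indirect Vickrey auction -/

/-- The sets of `min k n` agents whose bids are the highest. -/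
def topSets {n : ℕ} (k : ℕ) (s : Fin n → ℝ) : Finset (Finset (Fin n)) :=
  (Finset.powersetCard (min k n) Finset.univ).filter fun W => ∀ i ∈ W, ∀ j ∉ W, s j ≤ s i

theorem topSets_nonempty {n : ℕ} (k : ℕ) (s : Fin n → ℝ) : (topSets k s).Nonempty := by
  classical
  have hne : (Finset.powersetCard (min k n) (Finset.univ : Finset (Fin n))).Nonempty := by
    rw [Finset.powersetCard_nonempty]
    simp
  obtain ⟨W, hW, hmax⟩ := Finset.exists_max_image _ (fun W => ∑ i ∈ W, s i) hne
  refine ⟨W, Finset.mem_filter.2 ⟨hW, fun i hi j hj => ?_⟩⟩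
  have hc := (Finset.mem_powersetCard.1 hW).2
  have hj' : j ∉ W.erase i := fun h => hj (Finset.mem_of_mem_erase h)
  have hpos : 0 < W.card := Finset.card_pos.2 ⟨i, hi⟩
  have h := hmax (insert j (W.erase i)) (Finset.mem_powersetCard.2 ⟨Finset.subset_univ _, by
    rw [Finset.card_insert_of_notMem hj', Finset.card_erase_of_mem hi]
    omega⟩)
  rw [Finset.sum_insert hj', ← Finset.add_sum_erase W s hi] at h
  linarith

/-- The `k` highest bids win, ties are broken uniformly at random. -/
def topLottery {n : ℕ} (k : ℕ) (s : Fin n → ℝ) : PMF (Finset (Fin n)) :=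
  PMF.uniformOfFinset (topSets k s) (topSets_nonempty k s)

/-- The probability that agent `i` is among the winners of `topLottery`. -/
def topProb {n : ℕ} (k : ℕ) (s : Fin n → ℝ) (i : Fin n) : ℝ :=
  ∑ W : Finset (Fin n) with i ∈ W, (topLottery k s W).toReal

/-- The subrange `R'` of `[a, b]` on which the ironed virtual valuation increases: the valuations
with a larger ironed virtual valuation than every lower one. From an interval on which the ironed
virtual valuation is constant only the lower end point is kept, as the common bid of this
interval. -/
def bidSpace (a : ℝ) (b : EReal) (f : ℝ → ℝ) : Set ℝ :=
  {v ∈ valueRange a b | ∀ w ∈ valueRange a b, w < v → ironedValue a b f w < ironedValue a b f v}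

/-- The largest admissible bid that does not exceed `z`. -/
def roundDown (a : ℝ) (b : EReal) (f : ℝ → ℝ) (z : ℝ) : ℝ := sSup {r ∈ bidSpace a b f | r ≤ z}

/-- The indirect `k`-unit Vickrey auction: bids are restricted to `R'`, the top `k` bids win with
uniform tie-breaking, and agent `i` pays `sᵢ xᵢ(s) - ∫ₐ^{sᵢ} xᵢ(z, s₋ᵢ) dz`, where valuation `z`
means the bid of this valuation. -/
def indirectVickrey (n k : ℕ) (a : ℝ) (b : EReal) (f : ℝ → ℝ) :
    Mechanism n (bidSpace a b f) where
  lottery s := topLottery k fun j => (s j : ℝ)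
  payment s i := (s i : ℝ) * topProb k (fun j => (s j : ℝ)) i -
    ∫ z in a..(s i : ℝ), topProb k (Function.update (fun j => (s j : ℝ)) i (roundDown a b f z)) i

end MoneyBurning

end

/-!
By the envelope formula, the interim utility of an agent in equilibrium is the integral of its
interim winning probability `X`, which is monotone. The residual surplus is therefore the sum over
the agents of the integrals of `X` against the law of a valuation weighted by `ϑ = (1 - F) / f`.

Replace the weight `ϑ` by the ironed weight `g ∘ F`. The two weighted laws give the half-line
`(v, ∞)` the masses `H(1) - H(F(v))` and `G(1) - G(F(v))`. Since `G ≤ H` and `G(1) = H(1)`, the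
ironed mass is at least as large, and it is equal at the ends of the level sets of `g ∘ F`, because
`G` is affine where `G < H`. By the layer-cake formula, ironing does not decrease the integral of a
monotone `X`, and it preserves the integral if `X` is constant on these level sets.

Pointwise, the sum of the ironed values of the winners is maximal if the units go to the agents with
the highest ironed values. The auction allocates the units in this way, and since a bid is rounded
down to the lower end of a level set, its winning probabilities are constant on level sets.
-/

noncomputable section

namespace MoneyBurning

open Filter Topology
open scoped ENNReal

section RightDeriv

variable {φ : ℝ → ℝ} {c d : ℝ}

theorem slope_nonneg_of_monotoneOn {s : Set ℝ} (hm : MonotoneOn φ s) {x y : ℝ} (hx : x ∈ s)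
    (hy : y ∈ s) (hxy : x < y) : 0 ≤ slope φ x y := by
  rw [slope_def_field]
  exact div_nonneg (sub_nonneg.2 (hm hx hy hxy.le)) (sub_nonneg.2 hxy.le)

theorem differentiableWithinAt_Ioi_of_convexOn (hc : ConvexOn ℝ (Icc c d) φ)
    (hm : MonotoneOn φ (Icc c d)) {x : ℝ} (hx : x ∈ Ico c d) :
    DifferentiableWithinAt ℝ φ (Ioi x) x := by
  have hx' : x ∈ Icc c d := Ico_subset_Icc_self hx
  have hsub : Ioo x d ⊆ {y | y ∈ Icc c d ∧ x < y} :=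
    fun z hz => ⟨⟨hx.1.trans hz.1.le, hz.2.le⟩, hz.1⟩
  have hbdd : BddBelow (slope φ x '' Ioo x d) := ⟨0, forall_mem_image.2 fun z hz =>
    slope_nonneg_of_monotoneOn hm hx' (hsub hz).1 hz.1⟩
  have ht := ((hc.monotoneOn_slope_gt hx').mono hsub).tendsto_nhdsWithin_Ioo_right
    (nonempty_Ioo.2 hx.2) hbdd
  exact ((hasDerivWithinAt_iff_tendsto_slope' self_notMem_Ioi).2 ht).differentiableWithinAt

theorem differentiableWithinAt_Iio_right_of_convexOn (hcd : c < d) (hc : ConvexOn ℝ (Icc c d) φ)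
    {m : ℝ} (hb : ∀ x ∈ Icc c d, φ d - φ x ≤ m * (d - x)) :
    DifferentiableWithinAt ℝ φ (Iio d) d := by
  have hsub : Ioo c d ⊆ {y | y ∈ Icc c d ∧ y < d} := fun z hz => ⟨Ioo_subset_Icc_self hz, hz.2⟩
  have hbdd : BddAbove (slope φ d '' Ioo c d) := ⟨m, forall_mem_image.2 fun z hz => by
    rw [slope_comm, slope_def_field, div_le_iff₀ (sub_pos.2 hz.2)]
    exact hb z (hsub hz).1⟩
  have ht := ((hc.monotoneOn_slope_lt (right_mem_Icc.2 hcd.le)).mono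
    hsub).tendsto_nhdsWithin_Ioo_left (nonempty_Ioo.2 hcd) hbdd
  exact ((hasDerivWithinAt_iff_tendsto_slope' self_notMem_Iio).2 ht).differentiableWithinAt

theorem monotoneOn_rightDeriv_Ico (hc : ConvexOn ℝ (Icc c d) φ) (hm : MonotoneOn φ (Icc c d)) :
    MonotoneOn (fun x => derivWithin φ (Ioi x) x) (Ico c d) := by
  intro x hx y hy hxy
  rcases hxy.eq_or_lt with rfl | hxy
  · rfl
  have hx' : x ∈ Icc c d := Ico_subset_Icc_self hx
  have hy' : y ∈ interior (Icc c d) := by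
    rw [interior_Icc]
    exact ⟨hx.1.trans_lt hxy, hy.2⟩
  calc derivWithin φ (Ioi x) x ≤ slope φ x y := hc.rightDeriv_le_slope hx' (interior_subset hy')
        hxy (differentiableWithinAt_Ioi_of_convexOn hc hm hx)
    _ ≤ derivWithin φ (Iio y) y := hc.slope_le_leftDeriv_of_mem_interior hx' hy' hxy
    _ ≤ derivWithin φ (Ioi y) y := hc.leftDeriv_le_rightDeriv_of_mem_interior hy'

theorem le_rightDeriv_of_forall_le_slope (hc : ConvexOn ℝ (Icc c d) φ)
    (hm : MonotoneOn φ (Icc c d)) {x y L : ℝ} (hcx : c ≤ x) (hxy : x < y) (hyd : y ≤ d)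
    (hL : ∀ z ∈ Ioo x y, L ≤ slope φ x z) : L ≤ derivWithin φ (Ioi x) x := by
  have hd := (differentiableWithinAt_Ioi_of_convexOn hc hm
    ⟨hcx, hxy.trans_le hyd⟩).hasDerivWithinAt
  refine ge_of_tendsto ((hasDerivWithinAt_iff_tendsto_slope' self_notMem_Ioi).1 hd) ?_
  filter_upwards [Ioo_mem_nhdsGT hxy] with z hz using hL z hz

theorem rightDeriv_nonneg (hc : ConvexOn ℝ (Icc c d) φ) (hm : MonotoneOn φ (Icc c d)) {x : ℝ}
    (hx : x ∈ Ico c d) : 0 ≤ derivWithin φ (Ioi x) x :=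
  le_rightDeriv_of_forall_le_slope hc hm hx.1 hx.2 le_rfl fun _ hz =>
    slope_nonneg_of_monotoneOn hm (Ico_subset_Icc_self hx) ⟨hx.1.trans hz.1.le, hz.2.le⟩ hz.1

theorem rightDeriv_le_leftDeriv_right (hc : ConvexOn ℝ (Icc c d) φ) (hm : MonotoneOn φ (Icc c d))
    {m : ℝ} (hb : ∀ x ∈ Icc c d, φ d - φ x ≤ m * (d - x)) {x : ℝ} (hx : x ∈ Ico c d) :
    derivWithin φ (Ioi x) x ≤ derivWithin φ (Iio d) d := by
  have hcd : c < d := hx.1.trans_lt hx.2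
  have hx' : x ∈ Icc c d := Ico_subset_Icc_self hx
  have hd' : d ∈ Icc c d := right_mem_Icc.2 hcd.le
  calc derivWithin φ (Ioi x) x ≤ slope φ x d := hc.rightDeriv_le_slope hx' hd' hx.2
        (differentiableWithinAt_Ioi_of_convexOn hc hm hx)
    _ ≤ derivWithin φ (Iio d) d := hc.slope_le_leftDeriv hx' hd' hx.2
        (differentiableWithinAt_Iio_right_of_convexOn hcd hc hb)

theorem le_rightDeriv_of_forall_Ioo (hc : ConvexOn ℝ (Icc c d) φ) (hm : MonotoneOn φ (Icc c d))
    (hcont : ContinuousOn φ (Icc c d)) {x y L : ℝ} (hcx : c ≤ x) (hxy : x < y) (hyd : y ≤ d)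
    (hL : ∀ q ∈ Ioo x y, L ≤ derivWithin φ (Ioi q) q) : L ≤ derivWithin φ (Ioi x) x := by
  refine le_rightDeriv_of_forall_le_slope hc hm hcx hxy hyd fun z hz => ?_
  have hz' : z ∈ Icc c d := ⟨hcx.trans hz.1.le, hz.2.le.trans hyd⟩
  have hφ : Tendsto φ (𝓝[>] x) (𝓝 (φ x)) :=
    (hcont x ⟨hcx, hz.1.le.trans hz'.2⟩).mono_left (nhdsWithin_le_of_mem
      (mem_of_superset (Ioo_mem_nhdsGT hz.1) fun t ht => ⟨hcx.trans ht.1.le, ht.2.le.trans hz'.2⟩))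
  have hid : Tendsto (fun q : ℝ => q) (𝓝[>] x) (𝓝 x) := tendsto_id.mono_left nhdsWithin_le_nhds
  have hslope : Tendsto (fun q => slope φ q z) (𝓝[>] x) (𝓝 (slope φ x z)) := by
    simp only [slope_def_field]
    exact (tendsto_const_nhds.sub hφ).div (tendsto_const_nhds.sub hid) (sub_pos.2 hz.1).ne'
  refine ge_of_tendsto hslope ?_
  filter_upwards [Ioo_mem_nhdsGT hz.1] with q hq
  have hq' : q ∈ Ico c d := ⟨hcx.trans hq.1.le, hq.2.trans_le hz'.2⟩
  exact (hL q ⟨hq.1, hq.2.trans hz.2⟩).trans (hc.rightDeriv_le_slope (Ico_subset_Icc_self hq') hz'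
    hq.2 (differentiableWithinAt_Ioi_of_convexOn hc hm hq'))

theorem integrableOn_rightDeriv (hc : ConvexOn ℝ (Icc c d) φ) (hm : MonotoneOn φ (Icc c d))
    (hcont : ContinuousOn φ (Icc c d)) :
    IntegrableOn (fun x => derivWithin φ (Ioi x) x) (Ioc c d) :=
  intervalIntegral.integrableOn_deriv_right_of_nonneg hcont
    (fun _ hx => (differentiableWithinAt_Ioi_of_convexOn hc hm
      (Ioo_subset_Ico_self hx)).hasDerivWithinAt)
    (fun _ hx => rightDeriv_nonneg hc hm (Ioo_subset_Ico_self hx))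

theorem setIntegral_rightDeriv (hc : ConvexOn ℝ (Icc c d) φ) (hm : MonotoneOn φ (Icc c d))
    (hcont : ContinuousOn φ (Icc c d)) {x : ℝ} (hx : x ∈ Icc c d) :
    ∫ q in Ioc x d, derivWithin φ (Ioi q) q = φ d - φ x := by
  rw [← intervalIntegral.integral_of_le hx.2]
  refine intervalIntegral.integral_eq_sub_of_hasDeriv_right_of_le hx.2
    (hcont.mono (Icc_subset_Icc_left hx.1)) (fun q hq => (differentiableWithinAt_Ioi_of_convexOn
      hc hm ⟨hx.1.trans hq.1.le, hq.2⟩).hasDerivWithinAt) ?_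
  rw [intervalIntegrable_iff_integrableOn_Ioc_of_le hx.2]
  exact (integrableOn_rightDeriv hc hm hcont).mono_set (Ioc_subset_Ioc_left hx.1)

theorem setLIntegral_rightDeriv (hc : ConvexOn ℝ (Icc c d) φ) (hm : MonotoneOn φ (Icc c d))
    (hcont : ContinuousOn φ (Icc c d)) {x : ℝ} (hx : x ∈ Icc c d) :
    ∫⁻ q in Ioc x d, ENNReal.ofReal (derivWithin φ (Ioi q) q) = ENNReal.ofReal (φ d - φ x) := by
  rw [← setIntegral_rightDeriv hc hm hcont hx, ofReal_integral_eq_lintegral_ofReal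
    ((integrableOn_rightDeriv hc hm hcont).mono_set (Ioc_subset_Ioc_left hx.1))]
  rw [← restrict_Ioo_eq_restrict_Ioc]
  filter_upwards [ae_restrict_mem measurableSet_Ioo] with q hq
    using rightDeriv_nonneg hc hm ⟨hx.1.trans hq.1.le, hq.2⟩

end RightDeriv

section Chord

variable {φ : ℝ → ℝ} {s : Set ℝ} {x y r : ℝ}

theorem convexOn_line (hs : Convex ℝ s) (m c x : ℝ) : ConvexOn ℝ s fun r => c + m * (r - x) := by
  refine ⟨hs, fun u _ v _ t t' _ _ htt' => le_of_eq ?_⟩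
  simp only [smul_eq_mul]
  linear_combination (m * x - c) * htt'

theorem le_chord_of_mem_Icc (hc : ConvexOn ℝ s φ) (hx : x ∈ s) (hy : y ∈ s) (hr : r ∈ Icc x y) :
    φ r ≤ φ x + slope φ x y * (r - x) := by
  rcases hr.1.eq_or_lt with rfl | hxr
  · simp
  have hxy : x < y := hxr.trans_le hr.2
  have hslope : slope φ x r ≤ slope φ x y :=
    hc.slope_mono hx ⟨hc.1.ordConnected.out hx hy hr, hxr.ne'⟩ ⟨hy, hxy.ne'⟩ hr.2
  rw [slope_def_field φ x r, div_le_iff₀ (sub_pos.2 hxr)] at hslope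
  linarith

theorem chord_le_of_notMem_Icc (hc : ConvexOn ℝ s φ) (hx : x ∈ s) (hy : y ∈ s) (hxy : x < y)
    (hr : r ∈ s) (hrn : r ∉ Icc x y) : φ x + slope φ x y * (r - x) ≤ φ r := by
  rcases lt_or_ge r x with hrx | hxr
  · have hslope : slope φ x r ≤ slope φ x y :=
      hc.slope_mono hx ⟨hr, hrx.ne⟩ ⟨hy, hxy.ne'⟩ (hrx.trans hxy).le
    rw [slope_comm φ x r, slope_def_field φ r x, div_le_iff₀ (sub_pos.2 hrx)] at hslope
    linarith
  · have hyr : y < r := not_le.1 fun h => hrn ⟨hxr, h⟩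
    have hslope : slope φ x y ≤ slope φ x r :=
      hc.slope_mono hx ⟨hy, hxy.ne'⟩ ⟨hr, (hxy.trans hyr).ne'⟩ hyr.le
    rw [slope_def_field φ x r, le_div_iff₀ (sub_pos.2 (hxy.trans hyr))] at hslope
    linarith

end Chord

section ConvexMinorant

variable {H : ℝ → ℝ} {q : ℝ}

theorem le_convexMinorant {c : ℝ → ℝ} (hc : ConvexOn ℝ (Icc 0 1) c)
    (hle : ∀ r ∈ Icc (0 : ℝ) 1, c r ≤ H r) (hq : q ∈ Icc (0 : ℝ) 1) :
    c q ≤ convexMinorant H q := by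
  refine le_csSup ⟨H q, ?_⟩ ⟨c, hc, hle, rfl⟩
  rintro _ ⟨c', -, hle', rfl⟩
  exact hle' q hq

theorem line_le_convexMinorant {m c x : ℝ} (hle : ∀ r ∈ Icc (0 : ℝ) 1, c + m * (r - x) ≤ H r)
    (hq : q ∈ Icc (0 : ℝ) 1) : c + m * (q - x) ≤ convexMinorant H q :=
  le_convexMinorant (convexOn_line (convex_Icc 0 1) m c x) hle hq

theorem convexMinorant_le_of_forall (hH : BddBelow (H '' Icc 0 1)) {y : ℝ}
    (h : ∀ c : ℝ → ℝ, ConvexOn ℝ (Icc 0 1) c → (∀ r ∈ Icc (0 : ℝ) 1, c r ≤ H r) → c q ≤ y) :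
    convexMinorant H q ≤ y := by
  obtain ⟨B, hB⟩ := hH
  refine csSup_le ⟨B, fun _ => B, convexOn_const B (convex_Icc 0 1),
    fun r hr => hB (mem_image_of_mem H hr), rfl⟩ ?_
  rintro _ ⟨c, hc, hle, rfl⟩
  exact h c hc hle

theorem convexMinorant_le (hH : BddBelow (H '' Icc 0 1)) (hq : q ∈ Icc (0 : ℝ) 1) :
    convexMinorant H q ≤ H q :=
  convexMinorant_le_of_forall hH fun _ _ hle => hle q hq

theorem convexOn_convexMinorant (hH : BddBelow (H '' Icc 0 1)) :
    ConvexOn ℝ (Icc 0 1) (convexMinorant H) := by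
  refine ⟨convex_Icc 0 1, fun x hx y hy s t hs ht hst => ?_⟩
  refine convexMinorant_le_of_forall hH fun c hc hle => (hc.2 hx hy hs ht hst).trans ?_
  simp only [smul_eq_mul]
  gcongr
  exacts [le_convexMinorant hc hle hx, le_convexMinorant hc hle hy]

theorem le_convexMinorant_of_isMinOn (hmin : IsMinOn H (Icc 0 1) 0) (hq : q ∈ Icc (0 : ℝ) 1) :
    H 0 ≤ convexMinorant H q :=
  le_convexMinorant (convexOn_const (H 0) (convex_Icc 0 1)) (isMinOn_iff.1 hmin) hq

theorem bddBelow_image_of_isMinOn (hmin : IsMinOn H (Icc 0 1) 0) : BddBelow (H '' Icc 0 1) :=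
  ⟨H 0, forall_mem_image.2 (isMinOn_iff.1 hmin)⟩

theorem convexMinorant_zero (hmin : IsMinOn H (Icc 0 1) 0) : convexMinorant H 0 = H 0 :=
  le_antisymm (convexMinorant_le (bddBelow_image_of_isMinOn hmin) (left_mem_Icc.2 zero_le_one))
    (le_convexMinorant_of_isMinOn hmin (left_mem_Icc.2 zero_le_one))

theorem monotoneOn_convexMinorant (hmin : IsMinOn H (Icc 0 1) 0) :
    MonotoneOn (convexMinorant H) (Icc 0 1) := by
  intro x hx y hy hxy
  rcases hx.1.eq_or_lt with rfl | hx0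
  · rw [convexMinorant_zero hmin]
    exact le_convexMinorant_of_isMinOn hmin hy
  rcases hxy.eq_or_lt with rfl | hxy
  · rfl
  refine (convexOn_convexMinorant (bddBelow_image_of_isMinOn hmin)).le_right_of_left_le
    (left_mem_Icc.2 zero_le_one) hy ?_ ((convexMinorant_zero hmin).trans_le
      (le_convexMinorant_of_isMinOn hmin hx))
  rw [openSegment_eq_Ioo (hx0.trans hxy)]
  exact ⟨hx0, hxy⟩

theorem exists_line_le_of_lt (hH : BddBelow (H '' Icc 0 1))
    (hcont : ContinuousWithinAt H (Icc 0 1) 1) {y : ℝ} (hy : y < H 1) :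
    ∃ m, ∀ r ∈ Icc (0 : ℝ) 1, y + m * (r - 1) ≤ H r := by
  obtain ⟨B, hB⟩ := hH
  obtain ⟨δ, hδ, hnear⟩ := Metric.mem_nhdsWithin_iff.1 (hcont.eventually_const_lt hy)
  have hslope : 0 ≤ max 0 ((y - B) / δ) := le_max_left _ _
  refine ⟨max 0 ((y - B) / δ), fun r hr => ?_⟩
  by_cases hrδ : 1 - r < δ
  · have hyr : y < H r := hnear ⟨by
      rwa [Metric.mem_ball, Real.dist_eq, abs_sub_comm, abs_of_nonneg (sub_nonneg.2 hr.2)], hr⟩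
    nlinarith [hr.2]
  · have hyB : y - B ≤ max 0 ((y - B) / δ) * δ :=
      (div_le_iff₀ hδ).1 (le_max_right 0 ((y - B) / δ))
    have hBr : B ≤ H r := hB (mem_image_of_mem H hr)
    nlinarith

theorem le_convexMinorant_one (hH : BddBelow (H '' Icc 0 1))
    (hcont : ContinuousWithinAt H (Icc 0 1) 1) : H 1 ≤ convexMinorant H 1 := by
  refine le_of_forall_lt_imp_le_of_dense fun y hy => ?_
  obtain ⟨m, hm⟩ := exists_line_le_of_lt hH hcont hy
  simpa using line_le_convexMinorant hm (right_mem_Icc.2 zero_le_one)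

theorem convexMinorant_one (hH : BddBelow (H '' Icc 0 1))
    (hcont : ContinuousWithinAt H (Icc 0 1) 1) : convexMinorant H 1 = H 1 :=
  le_antisymm (convexMinorant_le hH (right_mem_Icc.2 zero_le_one)) (le_convexMinorant_one hH hcont)

theorem continuousWithinAt_convexMinorant_zero (hmin : IsMinOn H (Icc 0 1) 0)
    (hcont : ContinuousWithinAt H (Icc 0 1) 0) :
    ContinuousWithinAt (convexMinorant H) (Icc 0 1) 0 := by
  rw [ContinuousWithinAt, convexMinorant_zero hmin]
  refine tendsto_of_tendsto_of_tendsto_of_le_of_le' tendsto_const_nhds hcont ?_ ?_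
  · filter_upwards [self_mem_nhdsWithin] with r hr using le_convexMinorant_of_isMinOn hmin hr
  · filter_upwards [self_mem_nhdsWithin] with r hr
      using convexMinorant_le (bddBelow_image_of_isMinOn hmin) hr

theorem continuousWithinAt_convexMinorant_one (hH : BddBelow (H '' Icc 0 1))
    (hcont : ContinuousWithinAt H (Icc 0 1) 1) :
    ContinuousWithinAt (convexMinorant H) (Icc 0 1) 1 := by
  rw [ContinuousWithinAt, convexMinorant_one hH hcont]
  refine tendsto_order.2 ⟨fun y hy => ?_, fun y hy => ?_⟩
  · obtain ⟨z, hyz, hz⟩ := exists_between hy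
    obtain ⟨m, hm⟩ := exists_line_le_of_lt hH hcont hz
    have hline : Tendsto (fun r => z + m * (r - 1)) (𝓝[Icc 0 1] 1) (𝓝 (z + m * (1 - 1))) :=
      (Continuous.tendsto (by fun_prop) 1).mono_left nhdsWithin_le_nhds
    filter_upwards [self_mem_nhdsWithin, hline.eventually_const_lt (by simpa using hyz)]
      with r hr hlt using hlt.trans_le (line_le_convexMinorant hm hr)
  · filter_upwards [self_mem_nhdsWithin, hcont.eventually_lt_const hy] with r hr hlt
      using (convexMinorant_le hH hr).trans_lt hlt

theorem continuousOn_convexMinorant (hmin : IsMinOn H (Icc 0 1) 0)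
    (hcont : ContinuousOn H (Icc 0 1)) : ContinuousOn (convexMinorant H) (Icc 0 1) := by
  have hH := bddBelow_image_of_isMinOn hmin
  refine (convexOn_convexMinorant hH).continuousOn_Icc zero_lt_one ?_ ?_
  · exact (continuousWithinAt_convexMinorant_zero hmin
      (hcont 0 (left_mem_Icc.2 zero_le_one))).mono_of_mem_nhdsWithin (Icc_mem_nhdsGE zero_lt_one)
  · exact (continuousWithinAt_convexMinorant_one hH
      (hcont 1 (right_mem_Icc.2 zero_le_one))).mono_of_mem_nhdsWithin (Icc_mem_nhdsLE zero_lt_one)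

theorem convexMinorant_eq_chord (hH : BddBelow (H '' Icc 0 1)) {x y : ℝ}
    (hx : x ∈ Icc (0 : ℝ) 1) (hy : y ∈ Icc (0 : ℝ) 1) (hxy : x < y)
    (hchord : ∀ r ∈ Icc x y,
      convexMinorant H x + slope (convexMinorant H) x y * (r - x) ≤ H r) {r : ℝ}
    (hr : r ∈ Icc x y) :
    convexMinorant H r = convexMinorant H x + slope (convexMinorant H) x y * (r - x) := by
  set G := convexMinorant H
  set chord : ℝ → ℝ := fun r => G x + slope G x y * (r - x)
  have hG : ConvexOn ℝ (Icc 0 1) G := convexOn_convexMinorant hH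
  have hr01 : r ∈ Icc (0 : ℝ) 1 := Icc_subset_Icc hx.1 hy.2 hr
  -- The maximum of the minorant and its chord is again a convex function below `H`.
  have hmax : ∀ p ∈ Icc (0 : ℝ) 1, (G ⊔ chord) p ≤ H p := by
    intro p hp
    refine sup_le (convexMinorant_le hH hp) ?_
    by_cases hpxy : p ∈ Icc x y
    · exact hchord p hpxy
    · exact (chord_le_of_notMem_Icc hG hx hy hxy hp hpxy).trans (convexMinorant_le hH hp)
  have hchordG : (G ⊔ chord) r ≤ G r :=
    le_convexMinorant (hG.sup (convexOn_line (convex_Icc 0 1) _ _ _)) hmax hr01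
  exact le_antisymm (le_chord_of_mem_Icc hG hx hy hr)
    ((le_sup_right : chord r ≤ G r ⊔ chord r).trans hchordG)

theorem rightDeriv_convexMinorant_eq_slope (hH : BddBelow (H '' Icc 0 1)) {x y : ℝ}
    (hx : x ∈ Icc (0 : ℝ) 1) (hy : y ∈ Icc (0 : ℝ) 1) (hxy : x < y)
    (hchord : ∀ r ∈ Icc x y,
      convexMinorant H x + slope (convexMinorant H) x y * (r - x) ≤ H r) {p : ℝ}
    (hp : p ∈ Ico x y) :
    derivWithin (convexMinorant H) (Ioi p) p = slope (convexMinorant H) x y := by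
  set m := slope (convexMinorant H) x y
  have heq := fun r (hr : r ∈ Icc x y) => convexMinorant_eq_chord hH hx hy hxy hchord hr
  have hd : HasDerivWithinAt (fun r => convexMinorant H x + m * (r - x)) m (Ioi p) p := by
    simpa using ((((hasDerivAt_id p).sub_const x).const_mul m).const_add
      (convexMinorant H x)).hasDerivWithinAt
  refine (hd.congr_of_eventuallyEq ?_ (heq p (Ico_subset_Icc_self hp))).derivWithin
    (uniqueDiffWithinAt_Ioi p)
  filter_upwards [Ioo_mem_nhdsGT hp.2] with r hr using heq r ⟨hp.1.trans hr.1.le, hr.2.le⟩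

theorem exists_chord_le_of_convexMinorant_lt (hH : BddBelow (H '' Icc 0 1))
    (hq : q ∈ Ioo (0 : ℝ) 1) (hcont : ContinuousAt H q) (hlt : convexMinorant H q < H q) :
    ∃ x ∈ Ioo 0 q, ∃ y ∈ Ioo q 1, ∀ r ∈ Icc x y,
      convexMinorant H x + slope (convexMinorant H) x y * (r - x) ≤ H r := by
  set G := convexMinorant H
  have hG : ContinuousAt G q :=
    (convexOn_convexMinorant hH).continuousOn_interior.continuousAt (by
      rw [interior_Icc]
      exact Ioo_mem_nhds hq.1 hq.2)
  obtain ⟨M, hGM, hMH⟩ := exists_between hlt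
  obtain ⟨l, u, hlu, hsub⟩ := mem_nhds_iff_exists_Ioo_subset.1
    ((hcont.eventually_const_lt hMH).and
      ((hG.eventually_lt_const hGM).and (Ioo_mem_nhds hq.1 hq.2)))
  obtain ⟨x, hlx, hxq⟩ := exists_between hlu.1
  obtain ⟨y, hqy, hyu⟩ := exists_between hlu.2
  have hxy : x < y := hxq.trans hqy
  have hnear : ∀ r ∈ Icc x y, M < H r ∧ G r < M ∧ r ∈ Ioo (0 : ℝ) 1 := fun r hr =>
    hsub ⟨hlx.trans_le hr.1, hr.2.trans_lt hyu⟩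
  obtain ⟨-, hGx, hx01⟩ := hnear x (left_mem_Icc.2 hxy.le)
  obtain ⟨-, hGy, hy01⟩ := hnear y (right_mem_Icc.2 hxy.le)
  refine ⟨x, ⟨hx01.1, hxq⟩, y, ⟨hqy, hy01.2⟩, fun r hr => ?_⟩
  have hslope : slope G x y * (y - x) = G y - G x := by
    rw [slope_def_field, div_mul_cancel₀ _ (sub_pos.2 hxy).ne']
  -- The chord is below `M` at both ends, hence in between.
  have hchord : G x + slope G x y * (r - x) ≤ M := by
    rcases le_total 0 (slope G x y) with hslope_nonneg | hslope_nonpos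
    · linarith [mul_le_mul_of_nonneg_left (sub_le_sub_right hr.2 x) hslope_nonneg]
    · linarith [mul_nonpos_of_nonpos_of_nonneg hslope_nonpos (sub_nonneg.2 hr.1)]
  exact hchord.trans (hnear r hr).1.le

end ConvexMinorant

section ProbabilityIntegralTransform

variable (μ : Measure ℝ) [IsProbabilityMeasure μ]

theorem measure_Ioi_eq_ofReal_one_sub_cdf (x : ℝ) :
    μ (Ioi x) = ENNReal.ofReal (1 - cdf μ x) := by
  rw [← compl_Iic, prob_compl_eq_one_sub measurableSet_Iic, ← ofReal_cdf,
    ENNReal.ofReal_sub _ (cdf_nonneg μ x), ENNReal.ofReal_one]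

variable [NullSingletonClass μ]

theorem continuous_cdf : Continuous (cdf μ) := by
  refine continuous_iff_continuousAt.2 fun x => ?_
  have hjump := (cdf μ).measure_singleton x
  rw [measure_cdf, measure_singleton, eq_comm, ENNReal.ofReal_eq_zero, sub_nonpos] at hjump
  rw [(monotone_cdf μ).continuousAt_iff_leftLim_eq_rightLim, (cdf μ).rightLim_eq]
  exact le_antisymm ((monotone_cdf μ).leftLim_le le_rfl) hjump

theorem measure_cdf_preimage_Iic {q : ℝ} (hq : q < 1) :
    μ (cdf μ ⁻¹' Iic q) = ENNReal.ofReal q := by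
  rcases (cdf μ ⁻¹' Iic q).eq_empty_or_nonempty with hempty | hne
  · have hq0 : q ≤ 0 := ge_of_tendsto' (tendsto_cdf_atBot μ) fun x =>
      (not_le.1 fun hx => hempty.subset (mem_preimage.2 hx)).le
    rw [hempty, measure_empty, ENNReal.ofReal_of_nonpos hq0]
  · obtain ⟨z, hz⟩ := ((tendsto_cdf_atTop μ).eventually_const_lt hq).exists
    have hbdd : BddAbove (cdf μ ⁻¹' Iic q) :=
      ⟨z, fun x hx => (monotone_cdf μ).reflect_lt ((mem_Iic.1 hx).trans_lt hz) |>.le⟩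
    have hv : IsGreatest (cdf μ ⁻¹' Iic q) (sSup (cdf μ ⁻¹' Iic q)) :=
      (isClosed_Iic.preimage (continuous_cdf μ)).isGreatest_csSup hne hbdd
    set v := sSup (cdf μ ⁻¹' Iic q)
    have hFv : cdf μ v = q := le_antisymm hv.1 <|
      ge_of_tendsto (((continuous_cdf μ).tendsto v).mono_left nhdsWithin_le_nhds) <| by
        filter_upwards [self_mem_nhdsWithin] with x (hx : x ∈ Ioi v)
          using (not_le.1 fun h => not_le.2 hx (hv.2 h)).le
    have hIic : cdf μ ⁻¹' Iic q = Iic v :=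
      Subset.antisymm hv.2 fun x hx => (monotone_cdf μ hx).trans hv.1
    rw [hIic, ← ofReal_cdf, hFv]

theorem map_cdf : μ.map (cdf μ) = volume.restrict (Ioc 0 1) := by
  have hm : Measurable (cdf μ) := (monotone_cdf μ).measurable
  have := Measure.isProbabilityMeasure_map (μ := μ) hm.aemeasurable
  refine Measure.ext_of_Iic _ _ fun q => ?_
  rw [Measure.map_apply hm measurableSet_Iic, Measure.restrict_apply measurableSet_Iic,
    inter_comm, Ioc_inter_Iic, Real.volume_Ioc, sub_zero]
  rcases lt_or_ge q 1 with hq | hq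
  · rw [measure_cdf_preimage_Iic μ hq, inf_eq_right.2 hq.le]
  · have huniv : cdf μ ⁻¹' Iic q = univ := eq_univ_of_forall fun x => (cdf_le_one μ x).trans hq
    rw [huniv, measure_univ, inf_eq_left.2 hq, ENNReal.ofReal_one]

theorem cdf_preimage_Ioi_ae_eq (v : ℝ) : cdf μ ⁻¹' Ioi (cdf μ v) =ᵐ[μ] Ioi v := by
  have hm : Measurable (cdf μ) := (monotone_cdf μ).measurable
  have hsub : cdf μ ⁻¹' Ioi (cdf μ v) ⊆ Ioi v := fun _ hx => (monotone_cdf μ).reflect_lt hx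
  refine ae_eq_of_subset_of_measure_ge hsub (le_of_eq ?_)
    (hm measurableSet_Ioi).nullMeasurableSet (measure_ne_top _ _)
  rw [← Measure.map_apply hm measurableSet_Ioi, map_cdf, Measure.restrict_apply measurableSet_Ioi,
    inter_comm, Ioc_inter_Ioi, max_eq_right (cdf_nonneg μ v), Real.volume_Ioc,
    measure_Ioi_eq_ofReal_one_sub_cdf]

theorem setLIntegral_comp_cdf {φ : ℝ → ℝ≥0∞}
    (hφ : AEMeasurable φ (volume.restrict (Ioc 0 1))) (v : ℝ) :
    ∫⁻ z in Ioi v, φ (cdf μ z) ∂μ = ∫⁻ q in Ioc (cdf μ v) 1, φ q := by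
  have hm : Measurable (cdf μ) := (monotone_cdf μ).measurable
  have hIoc : Ioc (cdf μ v) 1 = Ioi (cdf μ v) ∩ Ioc 0 1 := by
    rw [inter_comm, Ioc_inter_Ioi, max_eq_right (cdf_nonneg μ v)]
  rw [hIoc, ← Measure.restrict_restrict measurableSet_Ioi, ← map_cdf μ,
    Measure.restrict_map hm measurableSet_Ioi,
    lintegral_map' (hφ.mono_measure ?_) hm.aemeasurable,
    Measure.restrict_congr_set (cdf_preimage_Ioi_ae_eq μ v)]
  rw [← Measure.restrict_map hm measurableSet_Ioi, map_cdf]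
  exact Measure.restrict_le_self

end ProbabilityIntegralTransform

section Law

variable {a : ℝ} {b : EReal} (f : ℝ → ℝ)

theorem measurableSet_valueRange (a : ℝ) (b : EReal) : MeasurableSet (valueRange a b) :=
  measurableSet_Ici.inter (measurable_coe_real_ereal measurableSet_Iic)

theorem mem_valueRange_of_le {v w : ℝ} (hv : v ∈ valueRange a b) (haw : a ≤ w) (hwv : w ≤ v) :
    w ∈ valueRange a b :=
  ⟨haw, (EReal.coe_le_coe_iff.2 hwv).trans hv.2⟩

theorem monotone_F : Monotone (F f) := monotone_cdf _

theorem measurable_F : Measurable (F f) := (monotone_F f).measurable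

theorem F_mem_Icc (z : ℝ) : F f z ∈ Icc (0 : ℝ) 1 := ⟨cdf_nonneg _ _, cdf_le_one _ _⟩

instance nullSingletonClass_law : NullSingletonClass (law f) :=
  ⟨fun x => withDensity_absolutelyContinuous _ _ (measure_singleton x)⟩

end Law

/-- The law of a valuation, weighted by `ψ`. The expected virtual surplus of an agent who wins with
probability `X v` at valuation `v` is the integral of `X` against the law weighted by the virtual
valuation. -/
def weightedLaw (f ψ : ℝ → ℝ) : Measure ℝ :=
  (law f).withDensity fun v => ENNReal.ofReal (ψ v)

instance nullSingletonClass_weightedLaw (f ψ : ℝ → ℝ) : NullSingletonClass (weightedLaw f ψ) :=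
  ⟨fun x => withDensity_absolutelyContinuous _ _ (measure_singleton x)⟩

namespace IsValuationDensity

variable {a : ℝ} {b : EReal} {f : ℝ → ℝ}

theorem nonneg (hf : IsValuationDensity a b f) (v : ℝ) : 0 ≤ f v := by
  by_cases hv : v ∈ valueRange a b
  · exact (hf.pos v hv).le
  · exact (hf.zero v hv).ge

theorem law_compl_valueRange (hf : IsValuationDensity a b f) : law f (valueRange a b)ᶜ = 0 := by
  have hR := (measurableSet_valueRange a b).compl
  rw [law, withDensity_apply _ hR]
  refine (setLIntegral_congr_fun hR fun v hv => ?_).trans lintegral_zero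
  rw [hf.zero v hv, ENNReal.ofReal_zero]

theorem ae_mem_valueRange (hf : IsValuationDensity a b f) : ∀ᵐ v ∂law f, v ∈ valueRange a b :=
  hf.law_compl_valueRange

theorem ae_weightedLaw_mem_valueRange (hf : IsValuationDensity a b f) (ψ : ℝ → ℝ) :
    ∀ᵐ v ∂weightedLaw f ψ, v ∈ valueRange a b :=
  (withDensity_absolutelyContinuous _ _).ae_le hf.ae_mem_valueRange

theorem left_mem_valueRange (hf : IsValuationDensity a b f) : a ∈ valueRange a b := by
  have := hf.isProbability
  obtain ⟨v, hv⟩ := hf.ae_mem_valueRange.exists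
  exact mem_valueRange_of_le hv le_rfl hv.1

theorem law_Ioi (hf : IsValuationDensity a b f) (z : ℝ) :
    law f (Ioi z) = ENNReal.ofReal (1 - F f z) := by
  have := hf.isProbability
  exact measure_Ioi_eq_ofReal_one_sub_cdf _ z

theorem continuous_F (hf : IsValuationDensity a b f) : Continuous (F f) := by
  have := hf.isProbability
  exact continuous_cdf _

theorem F_left (hf : IsValuationDensity a b f) : F f a = 0 := by
  have := hf.isProbability
  have hnull : law f (Iio a) = 0 :=
    measure_mono_null (subset_compl_iff_disjoint_right.2 <|
      disjoint_left.2 fun x hx hxR => not_le.2 hx hxR.1) hf.law_compl_valueRange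
  rw [measure_congr Iio_ae_eq_Iic, ← ofReal_cdf, ENNReal.ofReal_eq_zero] at hnull
  exact le_antisymm hnull (F_mem_Icc f a).1

theorem F_eq_one_of_notMem (hf : IsValuationDensity a b f) {z : ℝ} (haz : a ≤ z)
    (hz : z ∉ valueRange a b) : F f z = 1 := by
  have hnull : law f (Ioi z) = 0 := by
    refine measure_mono_null (subset_compl_iff_disjoint_right.2 <|
      disjoint_left.2 fun x hx hxR => hz ?_) hf.law_compl_valueRange
    exact mem_valueRange_of_le hxR haz (le_of_lt hx)
  rw [hf.law_Ioi, ENNReal.ofReal_eq_zero, sub_nonpos] at hnull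
  exact le_antisymm (F_mem_Icc f z).2 hnull

theorem strictMonoOn_F (hf : IsValuationDensity a b f) : StrictMonoOn (F f) (valueRange a b) := by
  intro v hv w hw hvw
  have := hf.isProbability
  have hpos : 0 < law f (Ioc v w) := by
    have hsub : Ioc v w ⊆ Function.support (fun x => ENNReal.ofReal (f x)) ∩ Ioc v w := by
      refine fun x hx => ⟨?_, hx⟩
      have hfx := hf.pos x (mem_valueRange_of_le hw (hv.1.trans hx.1.le) hx.2)
      exact (ENNReal.ofReal_pos.2 hfx).ne'
    rw [law, withDensity_apply _ measurableSet_Ioc,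
      setLIntegral_pos_iff hf.measurable.ennreal_ofReal]
    exact (by simpa using hvw : 0 < volume (Ioc v w)).trans_le (measure_mono hsub)
  rw [← measure_cdf (law f), StieltjesFunction.measure_Ioc, ENNReal.ofReal_pos] at hpos
  exact sub_pos.1 hpos

theorem exists_F_eq (hf : IsValuationDensity a b f) {q : ℝ} (hq : q ∈ Ico (0 : ℝ) 1) :
    ∃ v ∈ valueRange a b, F f v = q := by
  have := hf.isProbability
  obtain ⟨z, hz⟩ := ((tendsto_cdf_atTop (law f)).eventually_const_lt hq.2).exists
  have haz : a < z := (monotone_F f).reflect_lt (hf.F_left.trans_lt (hq.1.trans_lt hz))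
  obtain ⟨v, hv, hvq⟩ := intermediate_value_Icc haz.le hf.continuous_F.continuousOn
    (show q ∈ Icc (F f a) (F f z) from ⟨hf.F_left.symm ▸ hq.1, hz.le⟩)
  refine ⟨v, ?_, hvq⟩
  by_contra hvR
  exact hq.2.ne (hvq ▸ hf.F_eq_one_of_notMem hv.1 hvR)

theorem quantile_F (hf : IsValuationDensity a b f) {v : ℝ} (hv : v ∈ valueRange a b) :
    quantile a b f (F f v) = v := by
  have hleast : IsLeast {z ∈ valueRange a b | F f v ≤ F f z} v :=
    ⟨⟨hv, le_rfl⟩, fun z hz => (hf.strictMonoOn_F.le_iff_le hv hz.1).1 hz.2⟩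
  exact hleast.csInf_eq

theorem weightedLaw_comp_F_Ioi (hf : IsValuationDensity a b f) {φ : ℝ → ℝ}
    (hφ : AEMeasurable φ (volume.restrict (Ioc 0 1))) (v : ℝ) :
    weightedLaw f (φ ∘ F f) (Ioi v) = ∫⁻ q in Ioc (F f v) 1, ENNReal.ofReal (φ q) := by
  have := hf.isProbability
  rw [weightedLaw, withDensity_apply _ measurableSet_Ioi]
  exact setLIntegral_comp_cdf (law f) hφ.ennreal_ofReal v

theorem weightedLaw_congr (hf : IsValuationDensity a b f) {ψ₁ ψ₂ : ℝ → ℝ}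
    (h : EqOn ψ₁ ψ₂ (valueRange a b)) : weightedLaw f ψ₁ = weightedLaw f ψ₂ := by
  refine withDensity_congr_ae ?_
  filter_upwards [hf.ae_mem_valueRange] with v hv
  rw [h hv]

theorem virtualValue_nonneg (hf : IsValuationDensity a b f) (v : ℝ) : 0 ≤ virtualValue f v :=
  div_nonneg (sub_nonneg.2 (F_mem_Icc f v).2) (hf.nonneg v)

theorem measurable_virtualValue (hf : IsValuationDensity a b f) : Measurable (virtualValue f) :=
  (measurable_const.sub (measurable_F f)).div hf.measurable

theorem ofReal_density_mul_ofReal_virtualValue (hf : IsValuationDensity a b f) (z : ℝ) :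
    ENNReal.ofReal (f z) * ENNReal.ofReal (virtualValue f z) =
      (Ici a).indicator (fun z => law f (Ioi z)) z := by
  rw [← ENNReal.ofReal_mul (hf.nonneg z)]
  by_cases haz : a ≤ z
  · rw [indicator_of_mem (mem_Ici.2 haz), hf.law_Ioi]
    by_cases hz : z ∈ valueRange a b
    · rw [virtualValue, mul_div_cancel₀ _ (hf.pos z hz).ne']
    · rw [hf.zero z hz, hf.F_eq_one_of_notMem haz hz, zero_mul, sub_self]
  · rw [indicator_of_notMem (notMem_Ici.2 (not_le.1 haz)), hf.zero z fun hz => haz hz.1, zero_mul,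
      ENNReal.ofReal_zero]

theorem lintegral_weightedLaw_virtualValue (hf : IsValuationDensity a b f) {X : ℝ → ℝ≥0∞}
    (hX : Measurable X) :
    ∫⁻ v, X v ∂weightedLaw f (virtualValue f) = ∫⁻ v, ∫⁻ z in Ioc a v, X z ∂volume ∂law f := by
  have := hf.isProbability
  have hm : Measurable (fun p : ℝ × ℝ => (Ici p.2).indicator (fun _ => X p.2) p.1) :=
    Measurable.ite (measurableSet_le measurable_snd measurable_fst) (hX.comp measurable_snd)
      measurable_const
  calc ∫⁻ v, X v ∂weightedLaw f (virtualValue f)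
      = ∫⁻ z in Ici a, law f (Ioi z) * X z := by
        rw [weightedLaw, law,
          lintegral_withDensity_eq_lintegral_mul _ hf.measurable_virtualValue.ennreal_ofReal hX,
          lintegral_withDensity_eq_lintegral_mul _ hf.measurable.ennreal_ofReal
            (hf.measurable_virtualValue.ennreal_ofReal.mul hX),
          ← lintegral_indicator measurableSet_Ici]
        refine lintegral_congr fun z => ?_
        rw [Pi.mul_apply, Pi.mul_apply, ← mul_assoc, hf.ofReal_density_mul_ofReal_virtualValue,
          ← law, ← indicator_mul_left]
    _ = ∫⁻ z in Ici a, ∫⁻ v, (Ici z).indicator (fun _ => X z) v ∂law f := by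
        refine lintegral_congr fun z => ?_
        rw [lintegral_indicator_const measurableSet_Ici, measure_congr Ioi_ae_eq_Ici, mul_comm]
    _ = ∫⁻ v, ∫⁻ z in Ici a, (Ici z).indicator (fun _ => X z) v ∂volume ∂law f :=
        (lintegral_lintegral_swap hm.aemeasurable).symm
    _ = ∫⁻ v, ∫⁻ z in Ioc a v, X z ∂volume ∂law f := by
        refine lintegral_congr fun v => ?_
        rw [Measure.restrict_congr_set Ioi_ae_eq_Ici.symm, ← Ioi_inter_Iic, inter_comm,
          ← Measure.restrict_restrict measurableSet_Iic, ← lintegral_indicator measurableSet_Iic]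
        rfl

theorem isFiniteMeasure_weightedLaw_virtualValue (hf : IsValuationDensity a b f) :
    IsFiniteMeasure (weightedLaw f (virtualValue f)) := by
  have := hf.isProbability
  refine ⟨?_⟩
  rw [← lintegral_one, hf.lintegral_weightedLaw_virtualValue measurable_const]
  simp only [lintegral_one, Measure.restrict_apply_univ, Real.volume_Ioc]
  exact (hf.mean.sub (integrable_const a)).lintegral_lt_top

theorem weightedLaw_virtualValue_Ioi_le (hf : IsValuationDensity a b f) {u : ℝ} (hbu : b = u)
    (v : ℝ) : weightedLaw f (virtualValue f) (Ioi v) ≤ ENNReal.ofReal ((u - a) * (1 - F f v)) := by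
  have hua : 0 ≤ u - a := by
    have := hf.left_mem_valueRange.2
    rw [hbu, EReal.coe_le_coe_iff] at this
    exact sub_nonneg.2 this
  rw [← lintegral_indicator_one measurableSet_Ioi,
    hf.lintegral_weightedLaw_virtualValue (measurable_one.indicator measurableSet_Ioi),
    ENNReal.ofReal_mul hua, ← hf.law_Ioi, ← lintegral_indicator_const measurableSet_Ioi]
  refine lintegral_mono_ae ?_
  filter_upwards [hf.ae_mem_valueRange] with w hw
  rw [hbu] at hw
  have hwu : w ≤ u := EReal.coe_le_coe_iff.1 hw.2
  rw [lintegral_indicator_one measurableSet_Ioi, Measure.restrict_apply measurableSet_Ioi]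
  by_cases hvw : v < w
  · rw [indicator_of_mem (mem_Ioi.2 hvw)]
    refine (measure_mono inter_subset_right).trans ?_
    rw [Real.volume_Ioc]
    exact ENNReal.ofReal_le_ofReal (sub_le_sub_right hwu a)
  · have hempty : Ioi v ∩ Ioc a w = ∅ :=
      eq_empty_of_forall_notMem fun z hz => hvw ((mem_Ioi.1 hz.1).trans_le hz.2.2)
    rw [hempty, measure_empty]
    exact zero_le

theorem aemeasurable_hFun (hf : IsValuationDensity a b f) :
    AEMeasurable (hFun a b f) (volume.restrict (Ioc 0 1)) := by
  refine hf.measurable_virtualValue.comp_aemeasurable ?_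
  rw [← Measure.restrict_congr_set Ioo_ae_eq_Ioc]
  refine aemeasurable_restrict_of_monotoneOn measurableSet_Ioo fun q hq r hr hqr => ?_
  obtain ⟨v, hv, rfl⟩ := hf.exists_F_eq ⟨hq.1.le, hq.2⟩
  obtain ⟨w, hw, rfl⟩ := hf.exists_F_eq ⟨hr.1.le, hr.2⟩
  rw [hf.quantile_F hv, hf.quantile_F hw]
  exact (hf.strictMonoOn_F.le_iff_le hv hw).1 hqr

theorem hFun_nonneg (hf : IsValuationDensity a b f) (q : ℝ) : 0 ≤ hFun a b f q :=
  hf.virtualValue_nonneg _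

theorem weightedLaw_virtualValue_Ioi_eq_setLIntegral (hf : IsValuationDensity a b f) (v : ℝ) :
    weightedLaw f (virtualValue f) (Ioi v) =
      ∫⁻ q in Ioc (F f v) 1, ENNReal.ofReal (hFun a b f q) := by
  rw [← hf.weightedLaw_comp_F_Ioi hf.aemeasurable_hFun]
  refine congrArg (· (Ioi v)) (hf.weightedLaw_congr fun z hz => ?_)
  rw [Function.comp_apply, hFun, hf.quantile_F hz]

theorem integrableOn_hFun (hf : IsValuationDensity a b f) :
    IntegrableOn (hFun a b f) (Ioc 0 1) := by
  have := hf.isFiniteMeasure_weightedLaw_virtualValue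
  refine ⟨hf.aemeasurable_hFun.aestronglyMeasurable, ?_⟩
  rw [hasFiniteIntegral_iff_ofReal (Eventually.of_forall hf.hFun_nonneg), ← hf.F_left,
    ← hf.weightedLaw_virtualValue_Ioi_eq_setLIntegral]
  exact measure_lt_top _ _

theorem intervalIntegrable_hFun (hf : IsValuationDensity a b f) {p q : ℝ}
    (hp : p ∈ Icc (0 : ℝ) 1) (hq : q ∈ Icc (0 : ℝ) 1) :
    IntervalIntegrable (hFun a b f) volume p q :=
  ((intervalIntegrable_iff_integrableOn_Ioc_of_le zero_le_one).2 hf.integrableOn_hFun).mono_set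
    (by simpa [uIcc_of_le (zero_le_one' ℝ)] using uIcc_subset_Icc hp hq)

theorem monotoneOn_HFun (hf : IsValuationDensity a b f) :
    MonotoneOn (HFun a b f) (Icc 0 1) := by
  have h0 : (0 : ℝ) ∈ Icc (0 : ℝ) 1 := left_mem_Icc.2 zero_le_one
  intro p hp q hq hpq
  rw [← sub_nonneg, HFun, HFun, intervalIntegral.integral_interval_sub_left
    (hf.intervalIntegrable_hFun h0 hq) (hf.intervalIntegrable_hFun h0 hp)]
  exact intervalIntegral.integral_nonneg hpq fun r _ => hf.hFun_nonneg r

theorem isMinOn_HFun (hf : IsValuationDensity a b f) : IsMinOn (HFun a b f) (Icc 0 1) 0 :=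
  isMinOn_iff.2 fun _ hq => hf.monotoneOn_HFun (left_mem_Icc.2 zero_le_one) hq hq.1

theorem continuousOn_HFun (hf : IsValuationDensity a b f) :
    ContinuousOn (HFun a b f) (Icc 0 1) := by
  have h := intervalIntegral.continuousOn_primitive_interval (f := hFun a b f) (μ := volume)
    (a := 0) (b := 1) (by
      rw [uIcc_of_le zero_le_one, integrableOn_Icc_iff_integrableOn_Ioc]
      exact hf.integrableOn_hFun)
  rwa [uIcc_of_le zero_le_one] at h

theorem weightedLaw_virtualValue_Ioi (hf : IsValuationDensity a b f) (v : ℝ) :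
    weightedLaw f (virtualValue f) (Ioi v) =
      ENNReal.ofReal (HFun a b f 1 - HFun a b f (F f v)) := by
  have h0 : (0 : ℝ) ∈ Icc (0 : ℝ) 1 := left_mem_Icc.2 zero_le_one
  have hv := F_mem_Icc f v
  rw [hf.weightedLaw_virtualValue_Ioi_eq_setLIntegral, HFun, HFun,
    intervalIntegral.integral_interval_sub_left
      (hf.intervalIntegrable_hFun h0 (right_mem_Icc.2 zero_le_one))
      (hf.intervalIntegrable_hFun h0 hv),
    intervalIntegral.integral_of_le hv.2,
    ofReal_integral_eq_lintegral_ofReal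
      (hf.integrableOn_hFun.mono_set (Ioc_subset_Ioc_left hv.1))
      (Eventually.of_forall hf.hFun_nonneg)]

theorem HFun_one_sub_le (hf : IsValuationDensity a b f) {u : ℝ} (hbu : b = u) {q : ℝ}
    (hq : q ∈ Icc (0 : ℝ) 1) : HFun a b f 1 - HFun a b f q ≤ (u - a) * (1 - q) := by
  rcases hq.2.eq_or_lt with rfl | hq1
  · simp
  obtain ⟨v, -, rfl⟩ := hf.exists_F_eq ⟨hq.1, hq1⟩
  have hle := hf.weightedLaw_virtualValue_Ioi_le hbu v
  rw [hf.weightedLaw_virtualValue_Ioi] at hle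
  refine (ENNReal.ofReal_le_ofReal_iff (mul_nonneg ?_ (sub_nonneg.2 hq.2))).1 hle
  have := hf.left_mem_valueRange.2
  rw [hbu, EReal.coe_le_coe_iff] at this
  exact sub_nonneg.2 this

end IsValuationDensity

section Ironing

variable {a : ℝ} {b : EReal} {f : ℝ → ℝ}

theorem gFun_of_lt {q : ℝ} (hq : q < 1) :
    gFun a b f q = derivWithin (GFun a b f) (Ioi q) q := if_pos hq

theorem measurable_gFun : Measurable (gFun a b f) :=
  Measurable.ite measurableSet_Iio (measurable_derivWithin_Ioi _) measurable_const

theorem measurable_ironedValue : Measurable (ironedValue a b f) :=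
  measurable_gFun.comp (measurable_F f)

end Ironing

namespace IsValuationDensity

variable {a : ℝ} {b : EReal} {f : ℝ → ℝ}

theorem convexOn_GFun (hf : IsValuationDensity a b f) : ConvexOn ℝ (Icc 0 1) (GFun a b f) :=
  convexOn_convexMinorant (bddBelow_image_of_isMinOn hf.isMinOn_HFun)

theorem monotoneOn_GFun (hf : IsValuationDensity a b f) : MonotoneOn (GFun a b f) (Icc 0 1) :=
  monotoneOn_convexMinorant hf.isMinOn_HFun

theorem continuousOn_GFun (hf : IsValuationDensity a b f) :
    ContinuousOn (GFun a b f) (Icc 0 1) :=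
  continuousOn_convexMinorant hf.isMinOn_HFun hf.continuousOn_HFun

theorem GFun_zero (hf : IsValuationDensity a b f) : GFun a b f 0 = HFun a b f 0 :=
  convexMinorant_zero hf.isMinOn_HFun

theorem GFun_one (hf : IsValuationDensity a b f) : GFun a b f 1 = HFun a b f 1 :=
  convexMinorant_one (bddBelow_image_of_isMinOn hf.isMinOn_HFun)
    (hf.continuousOn_HFun 1 (right_mem_Icc.2 zero_le_one))

theorem GFun_le_HFun (hf : IsValuationDensity a b f) {q : ℝ} (hq : q ∈ Icc (0 : ℝ) 1) :
    GFun a b f q ≤ HFun a b f q :=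
  convexMinorant_le (bddBelow_image_of_isMinOn hf.isMinOn_HFun) hq

theorem GFun_one_sub_le (hf : IsValuationDensity a b f) {u : ℝ} (hbu : b = u) {q : ℝ}
    (hq : q ∈ Icc (0 : ℝ) 1) : GFun a b f 1 - GFun a b f q ≤ (u - a) * (1 - q) := by
  have hline : HFun a b f 1 + (u - a) * (q - 1) ≤ GFun a b f q :=
    line_le_convexMinorant (fun r hr => by linarith [hf.HFun_one_sub_le hbu hr]) hq
  rw [hf.GFun_one]
  linarith

theorem eq_of_F_eq_one (hf : IsValuationDensity a b f) {w : ℝ} (hw : w ∈ valueRange a b)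
    (hFw : F f w = 1) : b = w := by
  refine le_antisymm (not_lt.1 fun hwb => ?_) hw.2
  obtain ⟨x, hwx, hxb⟩ := EReal.lt_iff_exists_real_btwn.1 hwb
  have hwx' := EReal.coe_lt_coe_iff.1 hwx
  have hlt := hf.strictMonoOn_F hw (⟨hw.1.trans hwx'.le, hxb.le⟩ : x ∈ valueRange a b) hwx'
  exact hlt.not_ge (hFw ▸ (F_mem_Icc f x).2)

theorem monotoneOn_ironedValue (hf : IsValuationDensity a b f) :
    MonotoneOn (ironedValue a b f) (valueRange a b) := by
  intro v _ w hw hvw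
  have hFvw := monotone_F f hvw
  have hFv0 := (F_mem_Icc f v).1
  rcases (F_mem_Icc f w).2.eq_or_lt with hw1 | hw1
  · rcases (F_mem_Icc f v).2.eq_or_lt with hv1 | hv1
    · rw [ironedValue, ironedValue, hv1, hw1]
    · rw [ironedValue, ironedValue, hw1, gFun_of_lt hv1, gFun, if_neg (lt_irrefl 1)]
      exact rightDeriv_le_leftDeriv_right hf.convexOn_GFun hf.monotoneOn_GFun
        (fun q hq => hf.GFun_one_sub_le (hf.eq_of_F_eq_one hw hw1) hq) ⟨hFv0, hv1⟩
  · have hv1 := hFvw.trans_lt hw1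
    rw [ironedValue, ironedValue, gFun_of_lt hv1, gFun_of_lt hw1]
    exact monotoneOn_rightDeriv_Ico hf.convexOn_GFun hf.monotoneOn_GFun ⟨hFv0, hv1⟩
      ⟨(F_mem_Icc f w).1, hw1⟩ hFvw

theorem ironedValue_nonneg (hf : IsValuationDensity a b f) {v : ℝ} (hv : v ∈ valueRange a b) :
    0 ≤ ironedValue a b f v := by
  refine le_trans ?_ (hf.monotoneOn_ironedValue hf.left_mem_valueRange hv hv.1)
  rw [ironedValue, hf.F_left, gFun_of_lt one_pos]
  exact rightDeriv_nonneg hf.convexOn_GFun hf.monotoneOn_GFun ⟨le_rfl, one_pos⟩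

theorem exists_isLeast_level (hf : IsValuationDensity a b f) {v : ℝ} (hv : v ∈ valueRange a b) :
    ∃ r, IsLeast {w ∈ valueRange a b | ironedValue a b f w = ironedValue a b f v} r := by
  set S := {w ∈ valueRange a b | ironedValue a b f w = ironedValue a b f v}
  have hvS : v ∈ S := ⟨hv, rfl⟩
  have hbdd : BddBelow S := ⟨a, fun w hw => hw.1.1⟩
  have hrv : sInf S ≤ v := csInf_le hbdd hvS
  have hrR : sInf S ∈ valueRange a b :=
    mem_valueRange_of_le hv (le_csInf ⟨v, hvS⟩ fun w hw => hw.1.1) hrv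
  refine ⟨sInf S, ⟨hrR, ?_⟩, fun w hw => csInf_le hbdd hw⟩
  rcases hrv.eq_or_lt with hrv | hrv
  · rw [hrv]
  refine le_antisymm (hf.monotoneOn_ironedValue hrR hv hrv.le) ?_
  have hFrv := hf.strictMonoOn_F hrR hv hrv
  have hFv1 := (F_mem_Icc f v).2
  have hFr0 := (F_mem_Icc f (sInf S)).1
  rw [ironedValue.eq_1 a b f (sInf S), gFun_of_lt (hFrv.trans_le hFv1)]
  refine le_rightDeriv_of_forall_Ioo hf.convexOn_GFun hf.monotoneOn_GFun hf.continuousOn_GFun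
    hFr0 hFrv hFv1 fun q hq => ?_
  have hq1 : q < 1 := hq.2.trans_le hFv1
  obtain ⟨w, hw, rfl⟩ := hf.exists_F_eq ⟨hFr0.trans hq.1.le, hq1⟩
  have hrw := (hf.strictMonoOn_F.lt_iff_lt hrR hw).1 hq.1
  obtain ⟨s, hs, hsw⟩ := exists_lt_of_csInf_lt ⟨v, hvS⟩ hrw
  rw [← gFun_of_lt hq1, ← hs.2]
  exact hf.monotoneOn_ironedValue hs.1 hw hsw.le

theorem exists_isGreatest_bid (hf : IsValuationDensity a b f) {v : ℝ} (hv : v ∈ valueRange a b) :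
    ∃ r, IsGreatest {r ∈ bidSpace a b f | r ≤ v} r ∧
      ironedValue a b f r = ironedValue a b f v := by
  obtain ⟨r, hr, hmin⟩ := hf.exists_isLeast_level hv
  have hrv : r ≤ v := hmin ⟨hv, rfl⟩
  refine ⟨r, ⟨⟨⟨hr.1, fun w hw hwr => ?_⟩, hrv⟩, fun s hs => ?_⟩, hr.2⟩
  · refine lt_of_le_of_ne (hf.monotoneOn_ironedValue hw hr.1 hwr.le) fun h => ?_
    exact not_le.2 hwr (hmin ⟨hw, h.trans hr.2⟩)
  · by_contra! hrs
    have hlt := hs.1.2 r hr.1 hrs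
    rw [hr.2] at hlt
    exact not_le.2 hlt (hf.monotoneOn_ironedValue hs.1.1 hv hs.2)

theorem exists_ironedValue_eq_of_GFun_lt_HFun (hf : IsValuationDensity a b f) {c : ℝ}
    (hc : c ∈ valueRange a b) (hlt : GFun a b f (F f c) < HFun a b f (F f c)) :
    ∃ v ∈ valueRange a b, ∃ w ∈ valueRange a b,
      v < c ∧ c < w ∧ ironedValue a b f v = ironedValue a b f w := by
  have h0 : 0 < F f c := (F_mem_Icc f c).1.lt_of_ne fun h => by
    rw [← h, hf.GFun_zero] at hlt
    exact lt_irrefl _ hlt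
  have h1 : F f c < 1 := (F_mem_Icc f c).2.lt_of_ne fun h => by
    rw [h, hf.GFun_one] at hlt
    exact lt_irrefl _ hlt
  have hbdd := bddBelow_image_of_isMinOn hf.isMinOn_HFun
  obtain ⟨x, hx, y, hy, hchord⟩ := exists_chord_le_of_convexMinorant_lt hbdd ⟨h0, h1⟩
    (hf.continuousOn_HFun.continuousAt (Icc_mem_nhds h0 h1)) hlt
  obtain ⟨t, hct, hty⟩ := exists_between hy.1
  obtain ⟨v, hv, rfl⟩ := hf.exists_F_eq ⟨hx.1.le, hx.2.trans h1⟩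
  obtain ⟨w, hw, rfl⟩ := hf.exists_F_eq ⟨(h0.trans hct).le, hty.trans hy.2⟩
  have hslope : ∀ p ∈ Ico (F f v) y, gFun a b f p = slope (GFun a b f) (F f v) y := by
    intro p hp
    rw [gFun_of_lt (hp.2.trans hy.2)]
    exact rightDeriv_convexMinorant_eq_slope hbdd (F_mem_Icc f v) ⟨(h0.trans hy.1).le, hy.2.le⟩
      (hx.2.trans hy.1) hchord hp
  refine ⟨v, hv, w, hw, (hf.strictMonoOn_F.lt_iff_lt hv hc).1 hx.2,
    (hf.strictMonoOn_F.lt_iff_lt hc hw).1 hct, ?_⟩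
  exact (hslope _ ⟨le_rfl, hx.2.trans hy.1⟩).trans (hslope _ ⟨(hx.2.trans hct).le, hty⟩).symm

theorem weightedLaw_ironedValue_Ioi (hf : IsValuationDensity a b f) (v : ℝ) :
    weightedLaw f (ironedValue a b f) (Ioi v) =
      ENNReal.ofReal (GFun a b f 1 - GFun a b f (F f v)) := by
  have hderiv : ∫⁻ q in Ioc (F f v) 1, ENNReal.ofReal (gFun a b f q) =
      ∫⁻ q in Ioc (F f v) 1, ENNReal.ofReal (derivWithin (GFun a b f) (Ioi q) q) := by
    rw [← Measure.restrict_congr_set Ioo_ae_eq_Ioc]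
    exact setLIntegral_congr_fun measurableSet_Ioo fun q hq => by rw [gFun_of_lt hq.2]
  rw [← setLIntegral_rightDeriv hf.convexOn_GFun hf.monotoneOn_GFun hf.continuousOn_GFun
    (F_mem_Icc f v), ← hderiv]
  exact hf.weightedLaw_comp_F_Ioi measurable_gFun.aemeasurable v

theorem weightedLaw_virtualValue_Ioi_le_weightedLaw_ironedValue (hf : IsValuationDensity a b f)
    (v : ℝ) :
    weightedLaw f (virtualValue f) (Ioi v) ≤ weightedLaw f (ironedValue a b f) (Ioi v) := by
  rw [hf.weightedLaw_virtualValue_Ioi, hf.weightedLaw_ironedValue_Ioi, hf.GFun_one]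
  exact ENNReal.ofReal_le_ofReal (sub_le_sub_left (hf.GFun_le_HFun (F_mem_Icc f v)) _)

end IsValuationDensity

section UpperSets

variable {R U : Set ℝ} {m : Measure ℝ}

theorem ae_eq_Ioi_sInf_inter [NullSingletonClass m] (hR : BddBelow R) (hm : ∀ᵐ z ∂m, z ∈ R)
    (hU : ∀ x ∈ U ∩ R, ∀ y ∈ R, x ≤ y → y ∈ U) (hne : (U ∩ R).Nonempty) :
    U =ᵐ[m] Ioi (sInf (U ∩ R)) := by
  have hsInf : ∀ᵐ z ∂m, z ≠ sInf (U ∩ R) := by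
    rw [ae_iff]
    simp
  filter_upwards [hm, hsInf] with z hz hz_ne
  refine propext ⟨fun hzU => ?_, fun hlt => ?_⟩
  · exact lt_of_le_of_ne (csInf_le (hR.mono inter_subset_right) ⟨hzU, hz⟩) hz_ne.symm
  · obtain ⟨s, hs, hsz⟩ := exists_lt_of_csInf_lt hne hlt
    exact hU s hs z hz hsz.le

theorem measure_eq_zero_of_inter_eq_empty (hm : ∀ᵐ z ∂m, z ∈ R) (hempty : U ∩ R = ∅) :
    m U = 0 :=
  measure_mono_null (subset_compl_iff_disjoint_right.2 (disjoint_iff_inter_eq_empty.2 hempty)) hm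

end UpperSets

namespace IsValuationDensity

variable {a : ℝ} {b : EReal} {f : ℝ → ℝ} {U : Set ℝ} {X : ℝ → ℝ}

theorem weightedLaw_virtualValue_le_ironedValue (hf : IsValuationDensity a b f)
    (hU : ∀ x ∈ U ∩ valueRange a b, ∀ y ∈ valueRange a b, x ≤ y → y ∈ U) :
    weightedLaw f (virtualValue f) U ≤ weightedLaw f (ironedValue a b f) U := by
  have hR : BddBelow (valueRange a b) := ⟨a, fun _ hv => hv.1⟩
  have hae := hf.ae_weightedLaw_mem_valueRange
  rcases (U ∩ valueRange a b).eq_empty_or_nonempty with hempty | hne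
  · rw [measure_eq_zero_of_inter_eq_empty (hae _) hempty]
    exact zero_le
  · rw [measure_congr (ae_eq_Ioi_sInf_inter hR (hae _) hU hne),
      measure_congr (ae_eq_Ioi_sInf_inter hR (hae _) hU hne)]
    exact hf.weightedLaw_virtualValue_Ioi_le_weightedLaw_ironedValue _

theorem weightedLaw_virtualValue_eq_ironedValue (hf : IsValuationDensity a b f)
    (hU : ∀ x ∈ U ∩ valueRange a b, ∀ y ∈ valueRange a b, x ≤ y → y ∈ U)
    (hlevel : ∀ x ∈ valueRange a b, ∀ y ∈ valueRange a b,
      ironedValue a b f x = ironedValue a b f y → y ∈ U → x ∈ U) :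
    weightedLaw f (virtualValue f) U = weightedLaw f (ironedValue a b f) U := by
  have hR : BddBelow (valueRange a b) := ⟨a, fun _ hv => hv.1⟩
  have hae := hf.ae_weightedLaw_mem_valueRange
  rcases (U ∩ valueRange a b).eq_empty_or_nonempty with hempty | hne
  · rw [measure_eq_zero_of_inter_eq_empty (hae _) hempty,
      measure_eq_zero_of_inter_eq_empty (hae _) hempty]
  rw [measure_congr (ae_eq_Ioi_sInf_inter hR (hae _) hU hne),
    measure_congr (ae_eq_Ioi_sInf_inter hR (hae _) hU hne),
    hf.weightedLaw_virtualValue_Ioi, hf.weightedLaw_ironedValue_Ioi, hf.GFun_one]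
  have hbdd : BddBelow (U ∩ valueRange a b) := hR.mono inter_subset_right
  have hc : sInf (U ∩ valueRange a b) ∈ valueRange a b := by
    obtain ⟨x, hx⟩ := hne
    exact mem_valueRange_of_le hx.2 (le_csInf ⟨x, hx⟩ fun w hw => hw.2.1) (csInf_le hbdd hx)
  set c := sInf (U ∩ valueRange a b)
  suffices hGH : GFun a b f (F f c) = HFun a b f (F f c) by rw [hGH]
  -- Otherwise a level set, hence `U`, would reach below the infimum `c` of `U`.
  by_contra hGH
  obtain ⟨v, hv, w, hw, hvc, hcw, hvw⟩ := hf.exists_ironedValue_eq_of_GFun_lt_HFun hc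
    (lt_of_le_of_ne (hf.GFun_le_HFun (F_mem_Icc f c)) hGH)
  obtain ⟨s, hs, hsw⟩ := exists_lt_of_csInf_lt hne hcw
  exact not_le.2 hvc (csInf_le hbdd ⟨hlevel v hv w hw hvw (hU s hs w hw hsw.le), hv⟩)

theorem lintegral_weightedLaw_virtualValue_le (hf : IsValuationDensity a b f)
    (hX : Measurable X) (h0 : ∀ v, 0 ≤ X v) (hmono : MonotoneOn X (valueRange a b)) :
    ∫⁻ v, ENNReal.ofReal (X v) ∂weightedLaw f (virtualValue f) ≤
      ∫⁻ v, ENNReal.ofReal (X v) ∂weightedLaw f (ironedValue a b f) := by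
  rw [lintegral_eq_lintegral_meas_lt _ (Eventually.of_forall h0) hX.aemeasurable,
    lintegral_eq_lintegral_meas_lt _ (Eventually.of_forall h0) hX.aemeasurable]
  exact lintegral_mono fun t => hf.weightedLaw_virtualValue_le_ironedValue
    fun x hx y hy hxy => lt_of_lt_of_le hx.1 (hmono hx.2 hy hxy)

theorem lintegral_weightedLaw_virtualValue_eq (hf : IsValuationDensity a b f)
    (hX : Measurable X) (h0 : ∀ v, 0 ≤ X v) (hmono : MonotoneOn X (valueRange a b))
    (hlevel : ∀ x ∈ valueRange a b, ∀ y ∈ valueRange a b,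
      ironedValue a b f x = ironedValue a b f y → X x = X y) :
    ∫⁻ v, ENNReal.ofReal (X v) ∂weightedLaw f (virtualValue f) =
      ∫⁻ v, ENNReal.ofReal (X v) ∂weightedLaw f (ironedValue a b f) := by
  rw [lintegral_eq_lintegral_meas_lt _ (Eventually.of_forall h0) hX.aemeasurable,
    lintegral_eq_lintegral_meas_lt _ (Eventually.of_forall h0) hX.aemeasurable]
  refine lintegral_congr fun t => hf.weightedLaw_virtualValue_eq_ironedValue
    (fun x hx y hy hxy => lt_of_lt_of_le hx.1 (hmono hx.2 hy hxy)) fun x hx y hy hxy hyU => ?_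
  exact lt_of_lt_of_eq hyU (hlevel x hx y hy hxy).symm

end IsValuationDensity

section WinningProbabilities

variable {ι : Type*}

theorem sum_le_sum_of_card_eq_of_forall_notMem_le {W W' : Finset ι} {y : ι → ℝ}
    (hcard : W'.card = W.card) (htop : ∀ i ∈ W, ∀ j ∉ W, y j ≤ y i) :
    ∑ i ∈ W', y i ≤ ∑ i ∈ W, y i := by
  classical
  have hcard_sdiff : (W' \ W).card = (W \ W').card := Finset.card_sdiff_comm hcard
  rw [← Finset.sum_inter_add_sum_sdiff W' W, ← Finset.sum_inter_add_sum_sdiff W W',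
    Finset.inter_comm]
  refine add_le_add le_rfl ?_
  rcases (W' \ W).eq_empty_or_nonempty with hempty | hne
  · rw [hempty, Finset.card_empty, eq_comm, Finset.card_eq_zero] at hcard_sdiff
    rw [hempty, hcard_sdiff]
  obtain ⟨j, hj, hmax⟩ := Finset.exists_max_image _ y hne
  calc ∑ i ∈ W' \ W, y i ≤ (W' \ W).card • y j := Finset.sum_le_card_nsmul _ _ _ hmax
    _ = (W \ W').card • y j := by rw [hcard_sdiff]
    _ ≤ ∑ i ∈ W \ W', y i := Finset.card_nsmul_le_sum _ _ _ fun i hi =>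
        htop i (Finset.mem_sdiff.1 hi).1 j (Finset.mem_sdiff.1 hj).2

theorem sum_le_sum_of_card_le_of_forall_notMem_le {W W' : Finset ι} {y : ι → ℝ}
    (hcard : W'.card ≤ W.card) (hy : ∀ i, 0 ≤ y i) (htop : ∀ i ∈ W, ∀ j ∉ W, y j ≤ y i) :
    ∑ i ∈ W', y i ≤ ∑ i ∈ W, y i := by
  classical
  obtain ⟨V, hV, -, hVcard⟩ := Finset.exists_subsuperset_card_eq
    (Finset.subset_union_right (s₁ := W)) hcard (Finset.card_le_card Finset.subset_union_left)
  exact (Finset.sum_le_sum_of_subset_of_nonneg hV fun i _ _ => hy i).trans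
    (sum_le_sum_of_card_eq_of_forall_notMem_le hVcard htop)

variable [Fintype ι] [DecidableEq ι]

/-- The probability that `i` belongs to a random set of law `p`; the common form of
`Mechanism.alloc` and `topProb`. -/
def winProb (p : PMF (Finset ι)) (i : ι) : ℝ :=
  ∑ W : Finset ι with i ∈ W, (p W).toReal

theorem sum_toReal_pmf {α : Type*} [Fintype α] (p : PMF α) : ∑ x, (p x).toReal = 1 := by
  rw [← ENNReal.toReal_sum fun x _ => p.apply_ne_top x, ← tsum_fintype (L := .unconditional _),
    p.tsum_coe, ENNReal.toReal_one]

theorem winProb_nonneg (p : PMF (Finset ι)) (i : ι) : 0 ≤ winProb p i :=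
  Finset.sum_nonneg fun _ _ => ENNReal.toReal_nonneg

theorem winProb_le_one (p : PMF (Finset ι)) (i : ι) : winProb p i ≤ 1 := by
  rw [← sum_toReal_pmf p]
  exact Finset.sum_le_sum_of_subset_of_nonneg (Finset.filter_subset _ _)
    fun _ _ _ => ENNReal.toReal_nonneg

theorem sum_winProb_mul (p : PMF (Finset ι)) (y : ι → ℝ) :
    ∑ i, winProb p i * y i = ∑ W, (p W).toReal * ∑ i ∈ W, y i := by
  simp_rw [winProb, Finset.sum_filter, Finset.sum_mul, ite_mul, zero_mul, Finset.mul_sum]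
  rw [Finset.sum_comm]
  refine Finset.sum_congr rfl fun W _ => ?_
  rw [← Finset.sum_filter, Finset.filter_mem_eq_inter, Finset.univ_inter]

theorem sum_winProb_mul_le {p : PMF (Finset ι)} {y : ι → ℝ} {T : ℝ}
    (h : ∀ W ∈ p.support, ∑ i ∈ W, y i ≤ T) : ∑ i, winProb p i * y i ≤ T := by
  rw [sum_winProb_mul]
  calc ∑ W, (p W).toReal * ∑ i ∈ W, y i ≤ ∑ W, (p W).toReal * T := by
        refine Finset.sum_le_sum fun W _ => ?_
        by_cases hW : W ∈ p.support
        · exact mul_le_mul_of_nonneg_left (h W hW) ENNReal.toReal_nonneg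
        · rw [(p.apply_eq_zero_iff W).2 hW, ENNReal.toReal_zero, zero_mul, zero_mul]
    _ = T := by rw [← Finset.sum_mul, sum_toReal_pmf, one_mul]

theorem sum_winProb_mul_le_sum_winProb_mul {p q : PMF (Finset ι)} {y : ι → ℝ}
    (h : ∀ W ∈ p.support, ∀ V ∈ q.support, ∑ i ∈ W, y i ≤ ∑ i ∈ V, y i) :
    ∑ i, winProb p i * y i ≤ ∑ i, winProb q i * y i := by
  have hq : ∑ i, winProb q i * -y i ≤ -∑ i, winProb p i * y i :=
    sum_winProb_mul_le fun V hV => by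
      rw [Finset.sum_neg_distrib]
      exact neg_le_neg (sum_winProb_mul_le fun W hW => h W hW V hV)
  simpa only [mul_neg, Finset.sum_neg_distrib, neg_le_neg_iff] using hq

end WinningProbabilities

section TopBids

variable {n k : ℕ}

theorem mem_topSets {s : Fin n → ℝ} {W : Finset (Fin n)} :
    W ∈ topSets k s ↔ W.card = min k n ∧ ∀ i ∈ W, ∀ j ∉ W, s j ≤ s i := by
  simp only [topSets, Finset.mem_filter, Finset.mem_powersetCard, Finset.subset_univ, true_and]

theorem mem_support_topLottery {s : Fin n → ℝ} {W : Finset (Fin n)} :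
    W ∈ (topLottery k s).support ↔ W.card = min k n ∧ ∀ i ∈ W, ∀ j ∉ W, s j ≤ s i :=
  (PMF.mem_support_uniformOfFinset_iff _ _).trans mem_topSets

theorem topProb_nonneg (s : Fin n → ℝ) (i : Fin n) : 0 ≤ topProb k s i := winProb_nonneg _ _

theorem topProb_le_one (s : Fin n → ℝ) (i : Fin n) : topProb k s i ≤ 1 := winProb_le_one _ _

theorem sum_winProb_mul_le_sum_topProb_mul {p : PMF (Finset (Fin n))}
    (hp : ∀ W ∈ p.support, W.card ≤ k) {s y : Fin n → ℝ} (hy : ∀ i, 0 ≤ y i)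
    (hsy : ∀ i j, s j ≤ s i → y j ≤ y i) :
    ∑ i, winProb p i * y i ≤ ∑ i, topProb k s i * y i := by
  refine sum_winProb_mul_le_sum_winProb_mul fun W hW V hV => ?_
  rw [mem_support_topLottery] at hV
  have hcard : W.card ≤ V.card :=
    hV.1 ▸ le_min (hp W hW) ((Finset.card_le_univ W).trans_eq (Fintype.card_fin n))
  exact sum_le_sum_of_card_le_of_forall_notMem_le hcard hy
    fun i hi j hj => hsy i j (hV.2 i hi j hj)

theorem sum_topProb_mul_le_sum_topProb_mul_self (s s' : Fin n → ℝ) :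
    ∑ i, topProb k s' i * s i ≤ ∑ i, topProb k s i * s i := by
  refine sum_winProb_mul_le_sum_winProb_mul fun W hW V hV => ?_
  rw [mem_support_topLottery] at hW hV
  exact sum_le_sum_of_card_eq_of_forall_notMem_le (hW.1.trans hV.1.symm) hV.2

theorem monotone_topProb_update (s : Fin n → ℝ) (i : Fin n) :
    Monotone fun t => topProb k (Function.update s i t) i := by
  intro t t' htt'
  rcases htt'.eq_or_lt with rfl | hlt
  · rfl
  have hsum : ∀ (x : Fin n → ℝ) (r : ℝ), ∑ j, x j * Function.update s i r j =
      x i * r + ∑ j ∈ Finset.univ.erase i, x j * s j := by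
    intro x r
    rw [← Finset.add_sum_erase _ _ (Finset.mem_univ i), Function.update_self]
    congr 1
    exact Finset.sum_congr rfl fun j hj => by
      rw [Function.update_of_ne (Finset.ne_of_mem_erase hj)]
  -- Adding the optimality of the lottery at `t` and at `t'` leaves `(x(t') - x(t)) (t' - t) ≥ 0`.
  have hle := sum_topProb_mul_le_sum_topProb_mul_self (k := k)
    (Function.update s i t) (Function.update s i t')
  have hle' := sum_topProb_mul_le_sum_topProb_mul_self (k := k)
    (Function.update s i t') (Function.update s i t)
  rw [hsum, hsum] at hle hle'
  dsimp only
  nlinarith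

theorem finsetCongr_mem_topSets_iff (π : Equiv.Perm (Fin n)) (s : Fin n → ℝ)
    (W : Finset (Fin n)) : π.finsetCongr W ∈ topSets k s ↔ W ∈ topSets k (s ∘ π) := by
  simp only [mem_topSets, Equiv.finsetCongr_apply, Finset.card_map, Function.comp_apply]
  refine and_congr_right fun _ => ?_
  refine ⟨fun h i hi j hj => h (π i) (by simpa using hi) (π j) (by simpa using hj),
    fun h i hi j hj => ?_⟩
  rw [Finset.mem_map_equiv] at hi hj
  simpa using h (π.symm i) hi (π.symm j) hj

theorem card_topSets_comp (π : Equiv.Perm (Fin n)) (s : Fin n → ℝ) :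
    (topSets k (s ∘ π)).card = (topSets k s).card :=
  Finset.card_equiv π.finsetCongr fun W => (finsetCongr_mem_topSets_iff π s W).symm

theorem topLottery_comp_apply (π : Equiv.Perm (Fin n)) (s : Fin n → ℝ) (W : Finset (Fin n)) :
    topLottery k (s ∘ π) W = topLottery k s (π.finsetCongr W) := by
  simp only [topLottery, PMF.uniformOfFinset_apply, card_topSets_comp,
    finsetCongr_mem_topSets_iff]

theorem topLottery_comp (π : Equiv.Perm (Fin n)) (s : Fin n → ℝ) :
    topLottery k (s ∘ π) = (topLottery k s).map fun W => W.map π.symm.toEmbedding := by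
  classical
  ext W
  have hiff : ∀ V : Finset (Fin n), W = V.map π.symm.toEmbedding ↔ V = π.finsetCongr W :=
    fun V => π.symm.finsetCongr.symm_apply_eq.symm.trans eq_comm
  simp only [PMF.map_apply, hiff, topLottery_comp_apply]
  exact (tsum_ite_eq _ _).symm

theorem topProb_comp (π : Equiv.Perm (Fin n)) (s : Fin n → ℝ) (i : Fin n) :
    topProb k (s ∘ π) i = topProb k s (π i) :=
  Finset.sum_equiv π.finsetCongr (by simp) fun W _ => by rw [topLottery_comp_apply]

theorem measurableSet_setOf_mem_topSets (W : Finset (Fin n)) :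
    MeasurableSet {s : Fin n → ℝ | W ∈ topSets k s} := by
  simp only [mem_topSets, measurableSet_setOfPred]
  fun_prop

theorem measurable_card_topSets :
    Measurable fun s : Fin n → ℝ => ((topSets k s).card : ℝ≥0∞) := by
  have hsum (s : Fin n → ℝ) : ((topSets k s).card : ℝ≥0∞) =
      ∑ W : Finset (Fin n), if W ∈ topSets k s then 1 else 0 := by
    rw [Finset.sum_boole, Finset.filter_mem_eq_inter, Finset.univ_inter]
  simp only [hsum]
  exact Finset.measurable_fun_sum _ fun W _ =>
    Measurable.ite (measurableSet_setOf_mem_topSets W) measurable_const measurable_const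

theorem measurable_topProb (i : Fin n) : Measurable fun s : Fin n → ℝ => topProb k s i := by
  classical
  refine Finset.measurable_fun_sum _ fun W _ => Measurable.ennreal_toReal ?_
  simp only [topLottery, PMF.uniformOfFinset_apply]
  exact Measurable.ite (measurableSet_setOf_mem_topSets W) measurable_card_topSets.inv
    measurable_const

end TopBids

section Envelope

theorem sub_mul_le_intervalIntegral_of_monotoneOn {X : ℝ → ℝ} {s t : ℝ} (hst : s ≤ t)
    (hX : MonotoneOn X (Icc s t)) : (t - s) * X s ≤ ∫ z in s..t, X z := by
  have hint : IntervalIntegrable X volume s t :=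
    MonotoneOn.intervalIntegrable (by rwa [uIcc_of_le hst])
  rw [← smul_eq_mul, ← intervalIntegral.integral_const]
  exact intervalIntegral.integral_mono_on hst intervalIntegrable_const hint
    fun z hz => hX ⟨le_rfl, hst⟩ hz hz.1

theorem intervalIntegral_le_sub_mul_of_monotoneOn {X : ℝ → ℝ} {s t : ℝ} (hst : s ≤ t)
    (hX : MonotoneOn X (Icc s t)) : ∫ z in s..t, X z ≤ (t - s) * X t := by
  have hint : IntervalIntegrable X volume s t :=
    MonotoneOn.intervalIntegrable (by rwa [uIcc_of_le hst])
  rw [← smul_eq_mul, ← intervalIntegral.integral_const]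
  exact intervalIntegral.integral_mono_on hst hint intervalIntegrable_const
    fun z hz => hX hz ⟨hst, le_rfl⟩ hz.2

/-- `X w` is a subgradient of `U` at every `w ∈ S`, relative to `S`. For the indirect utility `U`
of an agent and its winning probability `X` this is incentive compatibility. -/
def IsSubgradientOn (U X : ℝ → ℝ) (S : Set ℝ) : Prop :=
  ∀ v ∈ S, ∀ w ∈ S, U w + (v - w) * X w ≤ U v

namespace IsSubgradientOn

variable {U X : ℝ → ℝ} {S T : Set ℝ}

theorem mono (h : IsSubgradientOn U X S) (hTS : T ⊆ S) : IsSubgradientOn U X T :=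
  fun v hv w hw => h v (hTS hv) w (hTS hw)

theorem monotoneOn (h : IsSubgradientOn U X S) : MonotoneOn X S := by
  intro v hv w hw hvw
  rcases hvw.eq_or_lt with rfl | hlt
  · rfl
  nlinarith [h v hv w hw, h w hw v hv]

theorem continuousOn_Icc {c d : ℝ} (h : IsSubgradientOn U X (Icc c d)) :
    ContinuousOn U (Icc c d) := by
  obtain ⟨K, hK⟩ : ∃ K : NNReal, ∀ v ∈ Icc c d, |X v| ≤ K := by
    refine ⟨(max |X c| |X d|).toNNReal, fun v hv => ?_⟩
    have hcd : c ≤ d := hv.1.trans hv.2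
    rw [Real.coe_toNNReal _ (le_max_of_le_left (abs_nonneg _))]
    exact abs_le_max_abs_abs (h.monotoneOn (left_mem_Icc.2 hcd) hv hv.1)
      (h.monotoneOn hv (right_mem_Icc.2 hcd) hv.2)
  have hle : ∀ v ∈ Icc c d, ∀ w ∈ Icc c d, U w ≤ U v + K * |w - v| := by
    intro v hv w hw
    have hbound : (w - v) * X w ≤ K * |w - v| :=
      calc (w - v) * X w ≤ |w - v| * |X w| := (le_abs_self _).trans_eq (abs_mul _ _)
        _ ≤ |w - v| * K := by gcongr; exact hK w hw
        _ = K * |w - v| := mul_comm _ _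
    linarith [h v hv w hw]
  exact (LipschitzOnWith.of_le_add_mul K fun w hw v hv => hle v hv w hw).continuousOn

theorem hasDerivAt (h : IsSubgradientOn U X S) {x : ℝ} (hx : S ∈ 𝓝 x) (hX : ContinuousAt X x) :
    HasDerivAt U (X x) x := by
  have hxS : x ∈ S := mem_of_mem_nhds hx
  have hle : ∀ᶠ v in 𝓝 x, ‖U v - U x - (v - x) • X x‖ ≤ 1 * ‖(v - x) * (X v - X x)‖ := by
    filter_upwards [hx] with v hv
    have hv_le := h x hxS v hv
    have hx_le := h v hv x hxS
    rw [one_mul, smul_eq_mul, Real.norm_of_nonneg (by linarith)]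
    exact le_trans (by linarith) (Real.le_norm_self _)
  have hsub : (fun v => X v - X x) =o[𝓝 x] fun _ => (1 : ℝ) :=
    (Asymptotics.isLittleO_one_iff ℝ).2 (tendsto_sub_nhds_zero_iff.2 hX)
  have hmul : (fun v => (v - x) * (X v - X x)) =o[𝓝 x] fun v => v - x := by
    simpa only [mul_one] using (Asymptotics.isBigO_refl (fun v => v - x) (𝓝 x)).mul_isLittleO hsub
  exact hasDerivAt_iff_isLittleO.2 ((Asymptotics.IsBigO.of_bound 1 hle).trans_isLittleO hmul)

theorem integral_eq_sub {c d : ℝ} (hcd : c ≤ d) (h : IsSubgradientOn U X (Icc c d)) :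
    ∫ z in c..d, X z = U d - U c := by
  have hmono : MonotoneOn X (Icc c d) := h.monotoneOn
  refine integral_eq_of_hasDerivAt_off_countable_of_le U X hcd
    hmono.countable_not_continuousWithinAt h.continuousOn_Icc (fun x hx => ?_)
    (MonotoneOn.intervalIntegrable (by rwa [uIcc_of_le hcd]))
  have hnhds : Icc c d ∈ 𝓝 x := Icc_mem_nhds hx.1.1 hx.1.2
  have hcont : ContinuousWithinAt X (Icc c d) x :=
    not_not.1 fun hnot => hx.2 ⟨Ioo_subset_Icc_self hx.1, hnot⟩
  exact h.hasDerivAt hnhds (hcont.continuousAt hnhds)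

end IsSubgradientOn

end Envelope

section RedrawCoordinate

variable {ι : Type*} [Fintype ι] {α : ι → Type*} [∀ i, MeasurableSpace (α i)]
  (μ : ∀ i, Measure (α i)) [∀ i, IsProbabilityMeasure (μ i)]

theorem ae_pi_forall {p : ∀ i, α i → Prop} (h : ∀ i, ∀ᵐ x ∂μ i, p i x) :
    ∀ᵐ w ∂Measure.pi μ, ∀ i, p i (w i) :=
  eventually_all.2 fun i => Measure.tendsto_eval_ae_ae.eventually (h i)

variable [DecidableEq ι]

theorem measurePreserving_update (i : ι) :
    MeasurePreserving (fun p : α i × (∀ j, α j) => Function.update p.2 i p.1)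
      ((μ i).prod (Measure.pi μ)) (Measure.pi μ) := by
  have hmeas : Measurable fun p : α i × (∀ j, α j) => Function.update p.2 i p.1 :=
    measurable_update'.comp measurable_swap
  refine ⟨hmeas, (Measure.pi_eq fun s hs => ?_).symm⟩
  have hpre : (fun p : α i × (∀ j, α j) => Function.update p.2 i p.1) ⁻¹' univ.pi s =
      s i ×ˢ univ.pi (Function.update s i univ) := by
    ext ⟨v, w⟩
    simp only [mem_preimage, mem_prod, mem_univ_pi, Function.forall_update_iff s
      (fun j t => w j ∈ t), Function.forall_update_iff w (fun j x => x ∈ s j), mem_univ, true_and]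
  rw [Measure.map_apply hmeas (MeasurableSet.univ_pi hs), hpre, Measure.prod_prod, Measure.pi_pi,
    ← Finset.mul_prod_erase _ _ (Finset.mem_univ i),
    ← Finset.mul_prod_erase _ (fun j => μ j (s j)) (Finset.mem_univ i), Function.update_self,
    measure_univ, one_mul]
  congr 1
  exact Finset.prod_congr rfl fun j hj => by
    rw [Function.update_of_ne (Finset.ne_of_mem_erase hj)]

theorem lintegral_pi_update (i : ι) {g : (∀ j, α j) → ℝ≥0∞} (hg : Measurable g) :
    ∫⁻ w, g w ∂Measure.pi μ =
      ∫⁻ v, ∫⁻ w, g (Function.update w i v) ∂Measure.pi μ ∂μ i := by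
  have hmp := measurePreserving_update μ i
  rw [← hmp.lintegral_comp hg]
  exact lintegral_prod _ (hg.comp hmp.measurable).aemeasurable

theorem integral_pi_update (i : ι) {E : Type*} [NormedAddCommGroup E] [NormedSpace ℝ E]
    {g : (∀ j, α j) → E} (hg : Integrable g (Measure.pi μ)) :
    ∫ w, g w ∂Measure.pi μ = ∫ v, ∫ w, g (Function.update w i v) ∂Measure.pi μ ∂μ i := by
  have hmp := measurePreserving_update μ i
  calc ∫ w, g w ∂Measure.pi μ
      = ∫ p : α i × (∀ j, α j), g (Function.update p.2 i p.1) ∂(μ i).prod (Measure.pi μ) := by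
        conv_lhs => rw [← hmp.map_eq]
        exact integral_map hmp.aemeasurable (hmp.map_eq.symm ▸ hg.aestronglyMeasurable)
    _ = _ := integral_prod _ (hmp.integrable_comp_of_integrable hg)

end RedrawCoordinate

namespace Mechanism

variable {n k : ℕ} {A : Type} {M : Mechanism n A} {a : ℝ} {b : EReal} {f : ℝ → ℝ}
  {σ : Fin n → ℝ → A}

theorem alloc_nonneg (M : Mechanism n A) (s : Fin n → A) (i : Fin n) : 0 ≤ M.alloc s i :=
  winProb_nonneg _ _

theorem alloc_le_one (M : Mechanism n A) (s : Fin n → A) (i : Fin n) : M.alloc s i ≤ 1 :=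
  winProb_le_one _ _

/-- The interim winning probability of agent `i` for action `t`, when the other agents draw their
valuations from `f` and follow `σ`. -/
def interimAlloc (M : Mechanism n A) (f : ℝ → ℝ) (σ : Fin n → ℝ → A) (i : Fin n) (t : A) : ℝ :=
  ∫ w, M.alloc (deviate σ i t w) i ∂(Measure.pi fun _ => law f)

/-- The interim payment of agent `i` for action `t`, when the other agents draw their valuations
from `f` and follow `σ`; it is `0` if the expectation is infinite. -/
def interimPayment (M : Mechanism n A) (f : ℝ → ℝ) (σ : Fin n → ℝ → A) (i : Fin n) (t : A) : ℝ :=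
  ∫ w, M.payment (deviate σ i t w) i ∂(Measure.pi fun _ => law f)

theorem interimUtility_eq_sub (M : Mechanism n A) (f : ℝ → ℝ) (σ : Fin n → ℝ → A) (i : Fin n)
    (v : ℝ) (t : A) :
    M.interimUtility f σ i v t = v * M.interimAlloc f σ i t - M.interimPayment f σ i t :=
  rfl

theorem interimAlloc_nonneg (i : Fin n) (t : A) : 0 ≤ M.interimAlloc f σ i t :=
  integral_nonneg fun _ => M.alloc_nonneg _ i

theorem interimAlloc_le_one [IsProbabilityMeasure (law f)] (i : Fin n) (t : A) :
    M.interimAlloc f σ i t ≤ 1 := by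
  refine (integral_mono_of_nonneg (Eventually.of_forall fun w => M.alloc_nonneg _ i)
    (integrable_const 1) (Eventually.of_forall fun w => M.alloc_le_one _ i)).trans_eq ?_
  rw [integral_const, probReal_univ, one_smul]

theorem lintegral_interimAlloc_weightedLaw_ne_top [IsProbabilityMeasure (law f)] (ψ : ℝ → ℝ)
    [IsFiniteMeasure (weightedLaw f ψ)] (i : Fin n) :
    ∫⁻ v, ENNReal.ofReal (M.interimAlloc f σ i (σ i v)) ∂weightedLaw f ψ ≠ ∞ := by
  have hle : ∀ v, ENNReal.ofReal (M.interimAlloc f σ i (σ i v)) ≤ 1 := fun v =>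
    ENNReal.ofReal_le_one.2 (interimAlloc_le_one i _)
  refine ((lintegral_mono hle).trans_lt ?_).ne
  rw [lintegral_one]
  exact measure_lt_top _ _

theorem update_comp_eq_deviate (σ : Fin n → ℝ → A) (i : Fin n) (v : ℝ) (w : Fin n → ℝ) :
    (fun j => σ j (Function.update w i v j)) = deviate σ i (σ i v) w := by
  ext j
  exact Function.apply_update σ w i v j

variable [MeasurableSpace A]

theorem measurable_profile (hσ : ∀ i, Measurable (σ i)) :
    Measurable fun w : Fin n → ℝ => fun j => σ j (w j) :=
  measurable_pi_lambda _ fun j => (hσ j).comp (measurable_pi_apply j)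

theorem measurable_deviate_prod (hσ : ∀ i, Measurable (σ i)) (i : Fin n) :
    Measurable fun p : A × (Fin n → ℝ) => deviate σ i p.1 p.2 :=
  measurable_update'.comp (((measurable_profile hσ).comp measurable_snd).prodMk measurable_fst)

theorem measurable_deviate (hσ : ∀ i, Measurable (σ i)) (i : Fin n) (t : A) :
    Measurable (deviate σ i t) :=
  (measurable_deviate_prod hσ i).comp measurable_prodMk_left

theorem integrable_alloc_deviate [IsProbabilityMeasure (law f)] (hM : M.IsFeasible k)
    (hσ : ∀ i, Measurable (σ i)) (i : Fin n) (t : A) :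
    Integrable (fun w => M.alloc (deviate σ i t w) i) (Measure.pi fun _ => law f) :=
  Integrable.of_mem_Icc 0 1 ((hM.measurable_alloc i).comp (measurable_deviate hσ i t)).aemeasurable
    (Eventually.of_forall fun _ => ⟨M.alloc_nonneg _ i, M.alloc_le_one _ i⟩)

theorem measurable_interimAlloc [IsProbabilityMeasure (law f)] (hM : M.IsFeasible k)
    (hσ : ∀ i, Measurable (σ i)) (i : Fin n) : Measurable (M.interimAlloc f σ i) :=
  ((hM.measurable_alloc i).comp
    (measurable_deviate_prod hσ i)).stronglyMeasurable.integral_prod_right'.measurable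

theorem measurable_interimPayment [IsProbabilityMeasure (law f)] (hM : M.IsFeasible k)
    (hσ : ∀ i, Measurable (σ i)) (i : Fin n) : Measurable (M.interimPayment f σ i) :=
  ((hM.measurable_payment i).comp
    (measurable_deviate_prod hσ i)).stronglyMeasurable.integral_prod_right'.measurable

theorem integrable_mul_alloc [IsProbabilityMeasure (law f)]
    (hmean : Integrable (fun v => v) (law f)) (hM : M.IsFeasible k)
    (hσ : ∀ i, Measurable (σ i)) (i : Fin n) :
    Integrable (fun w => w i * M.alloc (fun j => σ j (w j)) i) (Measure.pi fun _ => law f) := by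
  have hcoord : Integrable (fun w : Fin n → ℝ => w i) (Measure.pi fun _ => law f) :=
    (measurePreserving_eval (fun _ : Fin n => law f) i).integrable_comp_of_integrable hmean
  refine hcoord.mul_bdd
    (c := 1) ((hM.measurable_alloc i).comp (measurable_profile hσ)).aestronglyMeasurable
    (Eventually.of_forall fun w => ?_)
  rw [Real.norm_of_nonneg (M.alloc_nonneg _ i)]
  exact M.alloc_le_one _ i

theorem measurable_alloc_mul (hM : M.IsFeasible k) (hσ : ∀ i, Measurable (σ i)) {ψ : ℝ → ℝ}
    (hψ : Measurable ψ) (i : Fin n) :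
    Measurable fun w : Fin n → ℝ => M.alloc (fun j => σ j (w j)) i * ψ (w i) :=
  ((hM.measurable_alloc i).comp (measurable_profile hσ)).mul (hψ.comp (measurable_pi_apply i))

theorem lintegral_interimAlloc_weightedLaw [IsProbabilityMeasure (law f)] (hM : M.IsFeasible k)
    (hσ : ∀ i, Measurable (σ i)) {ψ : ℝ → ℝ} (hψ : Measurable ψ) (i : Fin n) :
    ∫⁻ v, ENNReal.ofReal (M.interimAlloc f σ i (σ i v)) ∂weightedLaw f ψ =
      ∫⁻ w, ENNReal.ofReal (M.alloc (fun j => σ j (w j)) i * ψ (w i))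
        ∂(Measure.pi fun _ => law f) := by
  have hX : Measurable fun v => M.interimAlloc f σ i (σ i v) :=
    (measurable_interimAlloc hM hσ i).comp (hσ i)
  have halloc : ∀ v, ENNReal.ofReal (M.interimAlloc f σ i (σ i v)) =
      ∫⁻ w, ENNReal.ofReal (M.alloc (deviate σ i (σ i v) w) i) ∂(Measure.pi fun _ => law f) :=
    fun v => ofReal_integral_eq_lintegral_ofReal (integrable_alloc_deviate hM hσ i _)
      (Eventually.of_forall fun w => M.alloc_nonneg _ i)
  rw [lintegral_pi_update (fun _ => law f) i (measurable_alloc_mul hM hσ hψ i).ennreal_ofReal,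
    weightedLaw, lintegral_withDensity_eq_lintegral_mul _ hψ.ennreal_ofReal hX.ennreal_ofReal]
  refine lintegral_congr fun v => ?_
  simp only [Pi.mul_apply, halloc, update_comp_eq_deviate, Function.update_self,
    ENNReal.ofReal_mul (M.alloc_nonneg _ i)]
  rw [lintegral_mul_const' _ _ ENNReal.ofReal_ne_top, mul_comm]

theorem sum_lintegral_interimAlloc_weightedLaw [IsProbabilityMeasure (law f)]
    (hM : M.IsFeasible k) (hσ : ∀ i, Measurable (σ i)) {ψ : ℝ → ℝ} (hψ : Measurable ψ)
    (hψ_nonneg : ∀ᵐ v ∂law f, 0 ≤ ψ v) :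
    ∑ i, ∫⁻ v, ENNReal.ofReal (M.interimAlloc f σ i (σ i v)) ∂weightedLaw f ψ =
      ∫⁻ w, ENNReal.ofReal (∑ i, M.alloc (fun j => σ j (w j)) i * ψ (w i))
        ∂(Measure.pi fun _ => law f) := by
  simp only [lintegral_interimAlloc_weightedLaw hM hσ hψ]
  rw [← lintegral_finsetSum _ fun i _ => (measurable_alloc_mul hM hσ hψ i).ennreal_ofReal]
  refine lintegral_congr_ae ?_
  filter_upwards [ae_pi_forall (fun _ : Fin n => law f) fun _ => hψ_nonneg] with w hw
  exact (ENNReal.ofReal_sum_of_nonneg fun i _ => mul_nonneg (M.alloc_nonneg _ i) (hw i)).symm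

namespace IsEquilibrium

theorem isSubgradientOn (hσ : M.IsEquilibrium a b f σ) (i : Fin n) :
    IsSubgradientOn (fun v => M.interimUtility f σ i v (σ i v))
      (fun v => M.interimAlloc f σ i (σ i v)) (valueRange a b) := by
  intro v hv w hw
  have hbest := hσ.best i v hv (σ i w) (hσ.finite i w hw)
  simp only [interimUtility_eq_sub] at hbest ⊢
  linarith

theorem interimUtility_left (ha : 0 ≤ a) (haR : a ∈ valueRange a b) (hM : M.IsFeasible k)
    (hσ : M.IsEquilibrium a b f σ) (i : Fin n) : M.interimUtility f σ i a (σ i a) = 0 := by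
  rcases ha.eq_or_lt with rfl | ha
  · refine le_antisymm ?_ (hσ.rational i 0 haR)
    rw [interimUtility, zero_mul, zero_sub, neg_nonpos]
    exact integral_nonneg fun w => hM.payment_nonneg _ i
  · exact hσ.normalized ha i

theorem interimUtility_eq_integral (ha : 0 ≤ a) (hM : M.IsFeasible k)
    (hσ : M.IsEquilibrium a b f σ) (i : Fin n) {v : ℝ} (hv : v ∈ valueRange a b) :
    M.interimUtility f σ i v (σ i v) = ∫ z in a..v, M.interimAlloc f σ i (σ i z) := by
  rw [((hσ.isSubgradientOn i).mono fun x hx => mem_valueRange_of_le hv hx.1 hx.2).integral_eq_sub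
    hv.1, hσ.interimUtility_left ha (mem_valueRange_of_le hv le_rfl hv.1) hM, sub_zero]

theorem interimPayment_le (ha : 0 ≤ a) [IsProbabilityMeasure (law f)]
    (hσ : M.IsEquilibrium a b f σ) (i : Fin n) {v : ℝ} (hv : v ∈ valueRange a b) :
    M.interimPayment f σ i (σ i v) ≤ v := by
  have hrational := hσ.rational i v hv
  rw [interimUtility_eq_sub, sub_nonneg] at hrational
  exact hrational.trans (mul_le_of_le_one_right (ha.trans hv.1) (interimAlloc_le_one i _))

theorem integrable_payment (ha : 0 ≤ a) (hf : IsValuationDensity a b f) (hM : M.IsFeasible k)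
    (hσ : M.IsEquilibrium a b f σ) (i : Fin n) :
    Integrable (fun w => M.payment (fun j => σ j (w j)) i) (Measure.pi fun _ => law f) := by
  have := hf.isProbability
  have hmp := measurePreserving_update (fun _ : Fin n => law f) i
  have hpay := (hM.measurable_payment i).comp (measurable_profile hσ.measurable)
  have hredraw (p : ℝ × (Fin n → ℝ)) : M.payment (fun j => σ j (Function.update p.2 i p.1 j)) i =
      M.payment (deviate σ i (σ i p.1) p.2) i := by rw [update_comp_eq_deviate]
  refine (hmp.integrable_comp hpay.aestronglyMeasurable).1 ?_
  refine (integrable_prod_iff (hpay.comp hmp.measurable).aestronglyMeasurable).2 ⟨?_, ?_⟩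
  · filter_upwards [hf.ae_mem_valueRange] with v hv
    simp only [Function.comp_apply, hredraw (v, _)]
    exact hσ.finite i v hv
  · refine hf.mean.mono' (hpay.comp
      hmp.measurable).stronglyMeasurable.norm.integral_prod_right'.aestronglyMeasurable ?_
    filter_upwards [hf.ae_mem_valueRange] with v hv
    simp only [Function.comp_apply, hredraw (v, _), Real.norm_of_nonneg (hM.payment_nonneg _ i)]
    rw [Real.norm_of_nonneg (integral_nonneg fun _ => hM.payment_nonneg _ i)]
    exact hσ.interimPayment_le ha i hv

theorem integrable_mul_alloc_sub_payment (ha : 0 ≤ a) (hf : IsValuationDensity a b f)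
    (hM : M.IsFeasible k) (hσ : M.IsEquilibrium a b f σ) (i : Fin n) :
    Integrable (fun w => w i * M.alloc (fun j => σ j (w j)) i -
      M.payment (fun j => σ j (w j)) i) (Measure.pi fun _ => law f) :=
  have := hf.isProbability
  (integrable_mul_alloc hf.mean hM hσ.measurable i).sub (hσ.integrable_payment ha hf hM i)

theorem integral_mul_alloc_sub_payment (ha : 0 ≤ a) (hf : IsValuationDensity a b f)
    (hM : M.IsFeasible k) (hσ : M.IsEquilibrium a b f σ) (i : Fin n) :
    ∫ w, (w i * M.alloc (fun j => σ j (w j)) i - M.payment (fun j => σ j (w j)) i)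
      ∂(Measure.pi fun _ => law f) = ∫ v, M.interimUtility f σ i v (σ i v) ∂law f := by
  have := hf.isProbability
  rw [integral_pi_update (fun _ => law f) i (hσ.integrable_mul_alloc_sub_payment ha hf hM i)]
  refine integral_congr_ae ?_
  filter_upwards [hf.ae_mem_valueRange] with v hv
  simp only [update_comp_eq_deviate, Function.update_self]
  rw [integral_sub ((integrable_alloc_deviate hM hσ.measurable i _).const_mul v)
    (hσ.finite i v hv), integral_const_mul, interimUtility]

theorem integral_interimUtility (ha : 0 ≤ a) (hf : IsValuationDensity a b f)
    (hM : M.IsFeasible k) (hσ : M.IsEquilibrium a b f σ) (i : Fin n) :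
    ∫ v, M.interimUtility f σ i v (σ i v) ∂law f =
      (∫⁻ v, ENNReal.ofReal (M.interimAlloc f σ i (σ i v))
        ∂weightedLaw f (virtualValue f)).toReal := by
  have := hf.isProbability
  have hX : Measurable fun v => M.interimAlloc f σ i (σ i v) :=
    (measurable_interimAlloc hM hσ.measurable i).comp (hσ.measurable i)
  have hP : Measurable fun v => M.interimPayment f σ i (σ i v) :=
    (measurable_interimPayment hM hσ.measurable i).comp (hσ.measurable i)
  rw [integral_eq_lintegral_of_nonneg_ae, hf.lintegral_weightedLaw_virtualValue hX.ennreal_ofReal]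
  · congr 1
    refine lintegral_congr_ae ?_
    filter_upwards [hf.ae_mem_valueRange] with v hv
    rw [hσ.interimUtility_eq_integral ha hM i hv, intervalIntegral.integral_of_le hv.1]
    exact ofReal_integral_eq_lintegral_ofReal (Integrable.of_mem_Icc 0 1 hX.aemeasurable
      (Eventually.of_forall fun z => ⟨interimAlloc_nonneg i _, interimAlloc_le_one i _⟩))
      (Eventually.of_forall fun z => interimAlloc_nonneg i _)
  · filter_upwards [hf.ae_mem_valueRange] with v hv using hσ.rational i v hv
  · exact ((measurable_id.mul hX).sub hP).aestronglyMeasurable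

theorem residualSurplus_eq (ha : 0 ≤ a) (hf : IsValuationDensity a b f) (hM : M.IsFeasible k)
    (hσ : M.IsEquilibrium a b f σ) :
    M.residualSurplus f σ =
      (∑ i, ∫⁻ v, ENNReal.ofReal (M.interimAlloc f σ i (σ i v))
        ∂weightedLaw f (virtualValue f)).toReal := by
  have := hf.isProbability
  have := hf.isFiniteMeasure_weightedLaw_virtualValue
  rw [residualSurplus,
    integral_finsetSum _ fun i _ => hσ.integrable_mul_alloc_sub_payment ha hf hM i,
    ENNReal.toReal_sum fun i _ => lintegral_interimAlloc_weightedLaw_ne_top _ i]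
  exact Finset.sum_congr rfl fun i _ => (hσ.integral_mul_alloc_sub_payment ha hf hM i).trans
    (hσ.integral_interimUtility ha hf hM i)

end IsEquilibrium

end Mechanism

section Bids

variable {a : ℝ} {b : EReal} {f : ℝ → ℝ}

namespace IsValuationDensity

theorem isGreatest_roundDown (hf : IsValuationDensity a b f) {v : ℝ} (hv : v ∈ valueRange a b) :
    IsGreatest {r ∈ bidSpace a b f | r ≤ v} (roundDown a b f v) := by
  obtain ⟨r, hr, -⟩ := hf.exists_isGreatest_bid hv
  rwa [roundDown, hr.csSup_eq]

theorem ironedValue_roundDown (hf : IsValuationDensity a b f) {v : ℝ} (hv : v ∈ valueRange a b) :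
    ironedValue a b f (roundDown a b f v) = ironedValue a b f v := by
  obtain ⟨r, hr, hvalue⟩ := hf.exists_isGreatest_bid hv
  rwa [roundDown, hr.csSup_eq]

theorem left_mem_bidSpace (hf : IsValuationDensity a b f) : a ∈ bidSpace a b f :=
  ⟨hf.left_mem_valueRange, fun _ hw hwa => absurd hw.1 (not_le.2 hwa)⟩

theorem ironedValue_le_of_roundDown_le (hf : IsValuationDensity a b f) {v w : ℝ}
    (hv : v ∈ valueRange a b) (hw : w ∈ valueRange a b)
    (h : roundDown a b f v ≤ roundDown a b f w) : ironedValue a b f v ≤ ironedValue a b f w := by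
  rw [← hf.ironedValue_roundDown hv, ← hf.ironedValue_roundDown hw]
  exact hf.monotoneOn_ironedValue (hf.isGreatest_roundDown hv).1.1.1
    (hf.isGreatest_roundDown hw).1.1.1 h

theorem roundDown_le_of_ironedValue_le (hf : IsValuationDensity a b f) {v w : ℝ}
    (hv : v ∈ valueRange a b) (hw : w ∈ valueRange a b)
    (h : ironedValue a b f v ≤ ironedValue a b f w) : roundDown a b f v ≤ roundDown a b f w := by
  contrapose! h
  rw [← hf.ironedValue_roundDown hv, ← hf.ironedValue_roundDown hw]
  exact (hf.isGreatest_roundDown hv).1.1.2 _ (hf.isGreatest_roundDown hw).1.1.1 h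

end IsValuationDensity

theorem roundDown_of_mem {t : ℝ} (ht : t ∈ bidSpace a b f) : roundDown a b f t = t :=
  IsGreatest.csSup_eq ⟨⟨ht, le_rfl⟩, fun _ hr => hr.2⟩

theorem monotone_roundDown (ha : 0 ≤ a) : Monotone (roundDown a b f) := by
  intro z z' hz
  rcases {r ∈ bidSpace a b f | r ≤ z}.eq_empty_or_nonempty with hempty | hne
  · -- No bid is below `z`, where the supremum is `0` by convention.
    rw [roundDown, hempty, Real.sSup_empty]
    exact Real.sSup_nonneg fun r hr => ha.trans hr.1.1.1
  · exact csSup_le_csSup ⟨z', fun r hr => hr.2⟩ hne fun r hr => ⟨hr.1, hr.2.trans hz⟩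

open Classical in
/-- The bid `β(v)` of the agents with valuation `v`: the largest admissible bid that does not
exceed `v`. Outside the range of valuations, where there need not be such a bid, it is `a`. -/
def bidStrategy (hf : IsValuationDensity a b f) (v : ℝ) : bidSpace a b f :=
  ⟨if v ∈ valueRange a b then roundDown a b f v else a, by
    split_ifs with hv
    · exact (hf.isGreatest_roundDown hv).1.1
    · exact hf.left_mem_bidSpace⟩

theorem coe_bidStrategy (hf : IsValuationDensity a b f) {v : ℝ} (hv : v ∈ valueRange a b) :
    (bidStrategy hf v : ℝ) = roundDown a b f v :=
  if_pos hv

theorem measurable_bidStrategy (ha : 0 ≤ a) (hf : IsValuationDensity a b f) :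
    Measurable (bidStrategy hf) := by
  classical
  exact (Measurable.ite (measurableSet_valueRange a b) (monotone_roundDown ha).measurable
    measurable_const).subtype_mk

theorem bidStrategy_eq_of_ironedValue_eq (hf : IsValuationDensity a b f) {v w : ℝ}
    (hv : v ∈ valueRange a b) (hw : w ∈ valueRange a b)
    (h : ironedValue a b f v = ironedValue a b f w) : bidStrategy hf v = bidStrategy hf w := by
  refine Subtype.ext ?_
  rw [coe_bidStrategy hf hv, coe_bidStrategy hf hw]
  exact le_antisymm (hf.roundDown_le_of_ironedValue_le hv hw h.le)
    (hf.roundDown_le_of_ironedValue_le hw hv h.ge)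

end Bids

section ThresholdPayment

/-- The truthful payment for the winning probability `ξ t` when an agent that reports `t` wins with
probability `ξ t` and the type `a` has utility `0`: the area above `ξ` up to the height `ξ t`. -/
def myersonPayment (ξ : ℝ → ℝ) (a t : ℝ) : ℝ := t * ξ t - ∫ z in a..t, ξ z

variable {ξ : ℝ → ℝ} {a t v : ℝ}

theorem myersonPayment_nonneg (hξ : Monotone ξ) (hξa : 0 ≤ ξ a) (ha : 0 ≤ a) (hat : a ≤ t) :
    0 ≤ myersonPayment ξ a t := by
  have harea := intervalIntegral_le_sub_mul_of_monotoneOn hat (hξ.monotoneOn _)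
  have hheight := mul_nonneg ha (hξa.trans (hξ hat))
  rw [myersonPayment]
  linarith

theorem myersonPayment_le_mul (hξ : ∀ z, 0 ≤ ξ z) (hat : a ≤ t) :
    myersonPayment ξ a t ≤ t * ξ t :=
  sub_le_self _ (intervalIntegral.integral_nonneg hat fun z _ => hξ z)

theorem mul_sub_myersonPayment_le (hξ : Monotone ξ) (a t v : ℝ) :
    v * ξ t - myersonPayment ξ a t ≤ ∫ z in a..v, ξ z := by
  have hadd := intervalIntegral.integral_add_adjacent_intervals
    (hξ.intervalIntegrable (μ := volume) (a := a) (b := t)) (hξ.intervalIntegrable (b := v))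
  rw [myersonPayment, ← hadd]
  rcases le_total t v with htv | hvt
  · have hgap := sub_mul_le_intervalIntegral_of_monotoneOn htv (hξ.monotoneOn _)
    linarith
  · have hgap := intervalIntegral_le_sub_mul_of_monotoneOn hvt (hξ.monotoneOn _)
    rw [intervalIntegral.integral_symm t v] at hgap
    linarith

theorem mul_sub_myersonPayment_eq (hξ : Monotone ξ) (htv : t ≤ v) (hlevel : ξ v = ξ t) :
    v * ξ t - myersonPayment ξ a t = ∫ z in a..v, ξ z := by
  refine le_antisymm (mul_sub_myersonPayment_le hξ a t v) ?_
  have hadd := intervalIntegral.integral_add_adjacent_intervals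
    (hξ.intervalIntegrable (μ := volume) (a := a) (b := t)) (hξ.intervalIntegrable (b := v))
  have hgap := intervalIntegral_le_sub_mul_of_monotoneOn htv (hξ.monotoneOn _)
  rw [hlevel] at hgap
  rw [myersonPayment, ← hadd]
  linarith

end ThresholdPayment

section Auction

variable {n k : ℕ} {a : ℝ} {b : EReal} {f : ℝ → ℝ}

theorem isSymmetric_indirectVickrey : (indirectVickrey n k a b f).IsSymmetric := by
  intro π s
  refine ⟨topLottery_comp π fun j => (s j : ℝ), fun i => ?_⟩
  have hprob : topProb k (fun j => (s (π j) : ℝ)) i = topProb k (fun j => (s j : ℝ)) (π i) :=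
    topProb_comp π (fun j => (s j : ℝ)) i
  have hrebid (z : ℝ) : topProb k (Function.update (fun j => (s (π j) : ℝ)) i z) i =
      topProb k (Function.update (fun j => (s j : ℝ)) (π i) z) (π i) := by
    rw [← topProb_comp π, Function.update_comp_eq_of_injective _ π.injective]
    rfl
  simp only [indirectVickrey, Function.comp_apply, hprob, hrebid]

/-- The winning probability of agent `i` as a function of its valuation, when the other agents bid
as in `s`. -/
def winCurve (k : ℕ) (a : ℝ) (b : EReal) (f : ℝ → ℝ) (s : Fin n → bidSpace a b f) (i : Fin n)
    (z : ℝ) : ℝ :=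
  topProb k (Function.update (fun j => (s j : ℝ)) i (roundDown a b f z)) i

theorem monotone_winCurve (ha : 0 ≤ a) (s : Fin n → bidSpace a b f) (i : Fin n) :
    Monotone (winCurve k a b f s i) :=
  (monotone_topProb_update _ i).comp (monotone_roundDown ha)

theorem winCurve_nonneg (s : Fin n → bidSpace a b f) (i : Fin n) (z : ℝ) :
    0 ≤ winCurve k a b f s i z :=
  topProb_nonneg _ _

theorem winCurve_update (s : Fin n → bidSpace a b f) (i : Fin n) (t : bidSpace a b f) :
    winCurve k a b f (Function.update s i t) i = winCurve k a b f s i := by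
  funext z
  rw [winCurve, winCurve]
  congr 1
  ext j
  by_cases hj : j = i
  · subst hj
    simp only [Function.update_self]
  · simp only [Function.update_of_ne hj]

theorem winCurve_roundDown {v : ℝ} (hf : IsValuationDensity a b f) (hv : v ∈ valueRange a b)
    (s : Fin n → bidSpace a b f) (i : Fin n) :
    winCurve k a b f s i (roundDown a b f v) = winCurve k a b f s i v := by
  rw [winCurve, winCurve, roundDown_of_mem (hf.isGreatest_roundDown hv).1.1]

theorem alloc_indirectVickrey (s : Fin n → bidSpace a b f) (i : Fin n) :
    (indirectVickrey n k a b f).alloc s i = winCurve k a b f s i (s i) := by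
  rw [winCurve, roundDown_of_mem (s i).2, Function.update_eq_self i fun j => (s j : ℝ)]
  rfl

theorem payment_indirectVickrey (s : Fin n → bidSpace a b f) (i : Fin n) :
    (indirectVickrey n k a b f).payment s i = myersonPayment (winCurve k a b f s i) a (s i) := by
  rw [myersonPayment, ← alloc_indirectVickrey]
  rfl

theorem payment_indirectVickrey_nonneg (ha : 0 ≤ a) (s : Fin n → bidSpace a b f) (i : Fin n) :
    0 ≤ (indirectVickrey n k a b f).payment s i := by
  rw [payment_indirectVickrey]
  exact myersonPayment_nonneg (monotone_winCurve ha s i) (winCurve_nonneg s i a) ha (s i).2.1.1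

theorem payment_indirectVickrey_le (ha : 0 ≤ a) (s : Fin n → bidSpace a b f) (i : Fin n) :
    (indirectVickrey n k a b f).payment s i ≤ s i := by
  rw [payment_indirectVickrey]
  exact (myersonPayment_le_mul (winCurve_nonneg s i) (s i).2.1.1).trans
    (mul_le_of_le_one_right (ha.trans (s i).2.1.1) (topProb_le_one _ _))

theorem measurable_coe_profile :
    Measurable fun s : Fin n → bidSpace a b f => fun j => (s j : ℝ) :=
  measurable_pi_lambda _ fun j => measurable_subtype_coe.comp (measurable_pi_apply j)

theorem measurable_winCurve_prod (ha : 0 ≤ a) (i : Fin n) :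
    Measurable fun p : (Fin n → bidSpace a b f) × ℝ => winCurve k a b f p.1 i p.2 :=
  (measurable_topProb i).comp (measurable_update'.comp
    ((measurable_coe_profile.comp measurable_fst).prodMk
      ((monotone_roundDown ha).measurable.comp measurable_snd)))

theorem measurable_payment_indirectVickrey (ha : 0 ≤ a) (i : Fin n) :
    Measurable fun s => (indirectVickrey n k a b f).payment s i := by
  have hbid : Measurable fun s : Fin n → bidSpace a b f => (s i : ℝ) :=
    measurable_subtype_coe.comp (measurable_pi_apply i)
  have hbelow : MeasurableSet {p : (Fin n → bidSpace a b f) × ℝ | p.2 ∈ Ioc a (p.1 i : ℝ)} :=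
    (measurableSet_lt measurable_const measurable_snd).inter
      (measurableSet_le measurable_snd (hbid.comp measurable_fst))
  have harea : Measurable fun s : Fin n → bidSpace a b f =>
      ∫ z in a..(s i : ℝ), winCurve k a b f s i z := by
    convert ((measurable_winCurve_prod (k := k) ha i).indicator
      hbelow).stronglyMeasurable.integral_prod_right' (ν := volume) |>.measurable using 2 with s
    rw [intervalIntegral.integral_of_le (s i).2.1.1, ← integral_indicator measurableSet_Ioc]
    rfl
  exact (hbid.mul ((measurable_topProb i).comp measurable_coe_profile)).sub harea

theorem isFeasible_indirectVickrey (ha : 0 ≤ a) : (indirectVickrey n k a b f).IsFeasible k where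
  units _ _ hW := (mem_support_topLottery.1 hW).1.trans_le (min_le_left _ _)
  measurable_alloc i := (measurable_topProb i).comp measurable_coe_profile
  measurable_payment i := measurable_payment_indirectVickrey ha i
  payment_nonneg s i := payment_indirectVickrey_nonneg ha s i

section Interim

variable [IsProbabilityMeasure (law f)] {σ : Fin n → ℝ → bidSpace a b f}

theorem finitePayment_indirectVickrey (ha : 0 ≤ a) (hσ : ∀ i, Measurable (σ i)) (i : Fin n)
    (t : bidSpace a b f) : (indirectVickrey n k a b f).FinitePayment f σ i t := by
  refine Integrable.of_mem_Icc 0 t ((measurable_payment_indirectVickrey ha i).comp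
    (Mechanism.measurable_deviate hσ i t)).aemeasurable (Eventually.of_forall fun w =>
      ⟨payment_indirectVickrey_nonneg ha _ i, (payment_indirectVickrey_le ha _ i).trans_eq ?_⟩)
  rw [Mechanism.deviate, Function.update_self]

theorem integrable_utility_indirectVickrey (ha : 0 ≤ a) (hσ : ∀ i, Measurable (σ i)) (i : Fin n)
    (v : ℝ) (t : bidSpace a b f) :
    Integrable (fun w => v * winCurve k a b f (fun j => σ j (w j)) i t -
      myersonPayment (winCurve k a b f (fun j => σ j (w j)) i) a t)
      (Measure.pi fun _ => law f) := by
  have halloc := Mechanism.integrable_alloc_deviate (f := f)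
    (isFeasible_indirectVickrey (k := k) ha) hσ i t
  have hpay := finitePayment_indirectVickrey (k := k) ha hσ i t
  refine ((halloc.const_mul v).sub hpay).congr (Eventually.of_forall fun w => ?_)
  simp only [Pi.sub_apply, alloc_indirectVickrey, payment_indirectVickrey, Mechanism.deviate,
    Function.update_self, winCurve_update]

theorem interimUtility_indirectVickrey (ha : 0 ≤ a) (hσ : ∀ i, Measurable (σ i)) (i : Fin n)
    (v : ℝ) (t : bidSpace a b f) :
    (indirectVickrey n k a b f).interimUtility f σ i v t =
      ∫ w, (v * winCurve k a b f (fun j => σ j (w j)) i t -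
        myersonPayment (winCurve k a b f (fun j => σ j (w j)) i) a t)
        ∂(Measure.pi fun _ => law f) := by
  have halloc := Mechanism.integrable_alloc_deviate (f := f)
    (isFeasible_indirectVickrey (k := k) ha) hσ i t
  have hpay := finitePayment_indirectVickrey (k := k) ha hσ i t
  rw [Mechanism.interimUtility, ← integral_const_mul, ← integral_sub (halloc.const_mul v) hpay]
  simp only [alloc_indirectVickrey, payment_indirectVickrey, Mechanism.deviate,
    Function.update_self, winCurve_update]

end Interim

theorem utility_bidStrategy (ha : 0 ≤ a) (hf : IsValuationDensity a b f)
    (s : Fin n → bidSpace a b f) (i : Fin n) {v : ℝ} (hv : v ∈ valueRange a b) :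
    v * winCurve k a b f s i (bidStrategy hf v) -
        myersonPayment (winCurve k a b f s i) a (bidStrategy hf v) =
      ∫ z in a..v, winCurve k a b f s i z := by
  rw [coe_bidStrategy hf hv]
  exact mul_sub_myersonPayment_eq (monotone_winCurve ha s i) (hf.isGreatest_roundDown hv).1.2
    (winCurve_roundDown hf hv s i).symm

theorem isEquilibrium_indirectVickrey (ha : 0 ≤ a) (hf : IsValuationDensity a b f) :
    (indirectVickrey n k a b f).IsEquilibrium a b f fun _ => bidStrategy hf := by
  have := hf.isProbability
  have hσ : ∀ _ : Fin n, Measurable (bidStrategy hf) := fun _ => measurable_bidStrategy ha hf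
  refine ⟨hσ, fun i v _ => finitePayment_indirectVickrey ha hσ i _, ?best, ?rational, ?normalized⟩
  case best =>
    intro i v hv t _
    rw [interimUtility_indirectVickrey ha hσ, interimUtility_indirectVickrey ha hσ]
    refine integral_mono (integrable_utility_indirectVickrey ha hσ i v t)
      (integrable_utility_indirectVickrey ha hσ i v _) fun w => ?_
    exact (mul_sub_myersonPayment_le (monotone_winCurve ha _ i) a t v).trans_eq
      (utility_bidStrategy ha hf _ i hv).symm
  case rational =>
    intro i v hv
    simp only [interimUtility_indirectVickrey ha hσ, utility_bidStrategy ha hf _ i hv]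
    exact integral_nonneg fun w =>
      intervalIntegral.integral_nonneg hv.1 fun z _ => winCurve_nonneg _ i z
  case normalized =>
    intro _ i
    simp only [interimUtility_indirectVickrey ha hσ,
      utility_bidStrategy ha hf _ i hf.left_mem_valueRange, intervalIntegral.integral_same,
      integral_zero]

theorem sum_alloc_mul_ironedValue_le_indirectVickrey (hf : IsValuationDensity a b f) {B : Type}
    [MeasurableSpace B] {M : Mechanism n B} (hM : M.IsFeasible k) (s : Fin n → B)
    {w : Fin n → ℝ} (hw : ∀ i, w i ∈ valueRange a b) :
    ∑ i, M.alloc s i * ironedValue a b f (w i) ≤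
      ∑ i, (indirectVickrey n k a b f).alloc (fun j => bidStrategy hf (w j)) i *
        ironedValue a b f (w i) := by
  refine sum_winProb_mul_le_sum_topProb_mul (s := fun j => (bidStrategy hf (w j) : ℝ))
    (hM.units s) (fun i => hf.ironedValue_nonneg (hw i)) fun i j hij => ?_
  rw [coe_bidStrategy hf (hw i), coe_bidStrategy hf (hw j)] at hij
  exact hf.ironedValue_le_of_roundDown_le (hw j) (hw i) hij

theorem residualSurplus_le_indirectVickrey (ha : 0 ≤ a) (hf : IsValuationDensity a b f)
    {B : Type} [MeasurableSpace B] {M : Mechanism n B} {τ : Fin n → ℝ → B}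
    (hM : M.IsFeasible k) (hτ : M.IsEquilibrium a b f τ) :
    M.residualSurplus f τ ≤
      (indirectVickrey n k a b f).residualSurplus f fun _ => bidStrategy hf := by
  have := hf.isProbability
  have := hf.isFiniteMeasure_weightedLaw_virtualValue
  have hV := isFeasible_indirectVickrey (n := n) (k := k) (b := b) (f := f) ha
  have hσ := isEquilibrium_indirectVickrey (n := n) (k := k) ha hf
  have hψ := measurable_ironedValue (a := a) (b := b) (f := f)
  have hψ_nonneg : ∀ᵐ v ∂law f, 0 ≤ ironedValue a b f v :=
    hf.ae_mem_valueRange.mono fun v hv => hf.ironedValue_nonneg hv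
  rw [hτ.residualSurplus_eq ha hf hM, hσ.residualSurplus_eq ha hf hV]
  refine ENNReal.toReal_mono (ENNReal.sum_ne_top.2 fun i _ =>
    Mechanism.lintegral_interimAlloc_weightedLaw_ne_top _ i) ?_
  calc ∑ i, ∫⁻ v, ENNReal.ofReal (M.interimAlloc f τ i (τ i v)) ∂weightedLaw f (virtualValue f)
      ≤ ∑ i, ∫⁻ v, ENNReal.ofReal (M.interimAlloc f τ i (τ i v))
          ∂weightedLaw f (ironedValue a b f) :=
        Finset.sum_le_sum fun i _ => hf.lintegral_weightedLaw_virtualValue_le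
          ((Mechanism.measurable_interimAlloc hM hτ.measurable i).comp (hτ.measurable i))
          (fun v => Mechanism.interimAlloc_nonneg i _) (hτ.isSubgradientOn i).monotoneOn
    _ = _ := Mechanism.sum_lintegral_interimAlloc_weightedLaw hM hτ.measurable hψ hψ_nonneg
    _ ≤ _ := by
        refine lintegral_mono_ae ?_
        filter_upwards [ae_pi_forall (fun _ : Fin n => law f) fun _ => hf.ae_mem_valueRange]
          with w hw
        exact ENNReal.ofReal_le_ofReal (sum_alloc_mul_ironedValue_le_indirectVickrey hf hM _ hw)
    _ = _ := (Mechanism.sum_lintegral_interimAlloc_weightedLaw hV hσ.measurable hψ hψ_nonneg).symm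
    _ = _ := Finset.sum_congr rfl fun i _ => Eq.symm <|
        hf.lintegral_weightedLaw_virtualValue_eq
          ((Mechanism.measurable_interimAlloc hV hσ.measurable i).comp (hσ.measurable i))
          (fun v => Mechanism.interimAlloc_nonneg i _) (hσ.isSubgradientOn i).monotoneOn
          fun x hx y hy hxy => congrArg _ (bidStrategy_eq_of_ironedValue_eq hf hx hy hxy)

end Auction

end MoneyBurning

end

theorem mainTheorem11_general (n k : ℕ) (a : ℝ) (b : EReal) (f : ℝ → ℝ) (ha : 0 ≤ a)
    (hf : MoneyBurning.IsValuationDensity a b f) :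
    (MoneyBurning.indirectVickrey n k a b f).IsSymmetric ∧
      ∃ σ : ℝ → MoneyBurning.bidSpace a b f,
        (∀ v ∈ MoneyBurning.valueRange a b,
          IsGreatest {r ∈ MoneyBurning.bidSpace a b f | r ≤ v} (σ v : ℝ) ∧
            MoneyBurning.ironedValue a b f (σ v) = MoneyBurning.ironedValue a b f v) ∧
        (MoneyBurning.indirectVickrey n k a b f).IsOptimal k a b f (fun _ => σ) := by
  refine ⟨MoneyBurning.isSymmetric_indirectVickrey, MoneyBurning.bidStrategy hf,
    fun v hv => ?_, ?_⟩
  · rw [MoneyBurning.coe_bidStrategy hf hv]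
    exact ⟨hf.isGreatest_roundDown hv, hf.ironedValue_roundDown hv⟩
  · exact ⟨MoneyBurning.isFeasible_indirectVickrey ha,
      MoneyBurning.isEquilibrium_indirectVickrey ha hf,
      fun _ _ _ _ hM hτ => MoneyBurning.residualSurplus_le_indirectVickrey ha hf hM hτ⟩

theorem mainTheorem11 (n k : ℕ) (a : ℝ) (b : EReal) (f : ℝ → ℝ) (ha : 0 ≤ a)
    (hab : (a : EReal) < b) (hf : MoneyBurning.IsValuationDensity a b f)
    (hnon : MoneyBurning.NonMHR a b f) :
    (MoneyBurning.indirectVickrey n k a b f).IsSymmetric ∧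
      ∃ σ : ℝ → MoneyBurning.bidSpace a b f,
        (∀ v ∈ MoneyBurning.valueRange a b,
          IsGreatest {r ∈ MoneyBurning.bidSpace a b f | r ≤ v} (σ v : ℝ) ∧
            MoneyBurning.ironedValue a b f (σ v) = MoneyBurning.ironedValue a b f v) ∧
        (MoneyBurning.indirectVickrey n k a b f).IsOptimal k a b f (fun _ => σ) :=
  mainTheorem11_general n k a b f ha hf
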